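/- Let $d\ge 0$ be an integer, let $\eta\in\mathbb R^d\setminus\{0\}$ and let $a(t,x,\xi)$ be a real function which is $C^\infty$ in some conic (in $\xi$) open neighbourhood $W\subset\mathbb R\times\mathbb R^d\times(\mathbb R^d\setminus\{0\})$ of $(0,0,\eta)$, homogeneous of degree $0$ in $\xi$, and such that $a(t,x,\xi)\ge 0$ for all $(t,x,\xi)\in W$ with $t\ge 0$. Put $p_2(t,x,\tau,\xi)=\tau^2-a(t,x,\xi)|\xi|^2$ and suppose that $(t,x,\tau,\xi)=(0,0,0,\eta)$ is an effectively hyperbolic singular point of $p_2=0$; that is, $p_2$ and $dp_2$ vanish there and, with $X=(t,x)$ and $\Xi=(\tau,\xi)$, the Hamilton map $$F_{p_2}=\begin{bmatrix}\dfrac{\partial^2p_2}{\partial\Xi\,\partial X}&\dfrac{\partial^2p_2}{\partial\Xi\,\partial\Xi}\\[2mm]-\dfrac{\partial^2p_2}{\partial X\,\partial X}&-\dfrac{\partial^2p_2}{\partial X\,\partial\Xi}\end{bmatrix}$$ (in each block the row index belongs to the first variable named and the column index to the second) has a pair $\pm\mu$ of non-zero real eigenvalues there. Then there exist a conic open neighbourhood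 $V\subset\mathbb R^d\times(\mathbb R^d\setminus\{0\})$ of $(0,\eta)$, a number $T>0$ with $[0,T)\times V\subset W$, a real $C^\infty$ function $\psi(x,\xi)$ on $V$, homogeneous of degree $0$ in $\xi$, and constants $0<\kappa<1$ and $c>0$ such that $$|\xi|^2\,\{\psi,a\}^2\le 4\kappa\,a(t,x,\xi),\qquad a(t,x,\xi)\ge c\,\min\big\{t^2,(t-\psi(x,\xi))^2\big\}$$ for all $(x,\xi)\in V$ and $0\le t<T$, where $\{\psi,a\}=\sum_{j=1}^d\big(\partial_{\xi_j}\psi\,\partial_{x_j}a-\partial_{x_j}\psi\,\partial_{\xi_j}a\big)$. (In particular $\{\psi,a\}^2\le 4\kappa a$ for $|\xi|\ge 1$.) Moreover $\psi$ satisfies the symbol estimates of order $0$: for all multi-indices $\alpha,\beta$ there is a constant $C_{\alpha\beta}$ such that $|\partial_x^\alpha\partial_\xi^\beta\psi(x,\xi)|\le C_{\alpha\beta}\,(1+|\xi|^2)^{-|\beta|/2}$ for all $(x,\xi)\in V$ with $|\xi|\ge 1$. -/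

import Mathlib

open scoped ContDiff

noncomputable section

/-- The Euclidean space `ℝᵈ`, in which the space variable `x` and its dual variable `ξ` live. -/
abbrev Esp (d : ℕ) : Type := EuclideanSpace ℝ (Fin d)

/-- The space of `X = (t, x)` and of `Ξ = (τ, ξ)`. -/
abbrev TXsp (d : ℕ) : Type := ℝ × Esp d

/-- The coordinate vectors of `ℝ × ℝᵈ`; the index `Sum.inl ()` is the time coordinate. -/
def coordVec (d : ℕ) : Unit ⊕ Fin d → TXsp d :=
  Sum.elim (fun _ => (1, 0)) (fun j => (0, EuclideanSpace.single j 1))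

/-- The second derivative of `p` at `ρ` in the directions `u`, `v`. -/
def secondDeriv {d : ℕ} (p : TXsp d × TXsp d → ℝ) (ρ u v : TXsp d × TXsp d) : ℝ :=
  fderiv ℝ (fderiv ℝ p) ρ u v

/-- The Hamilton map (fundamental matrix) of `p = p(X, Ξ)` at `ρ`, acting on column vectors
`(X, Ξ)`: its blocks are `∂²p/∂Ξ∂X`, `∂²p/∂Ξ∂Ξ`, `-∂²p/∂X∂X`, `-∂²p/∂X∂Ξ`, where the row index
belongs to the first variable that is named and the column index to the second one. -/
def hamiltonMap {d : ℕ} (p : TXsp d × TXsp d → ℝ) (ρ : TXsp d × TXsp d) :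
    Matrix ((Unit ⊕ Fin d) ⊕ (Unit ⊕ Fin d)) ((Unit ⊕ Fin d) ⊕ (Unit ⊕ Fin d)) ℝ :=
  Matrix.fromBlocks
    (Matrix.of fun i j => secondDeriv p ρ (0, coordVec d i) (coordVec d j, 0))
    (Matrix.of fun i j => secondDeriv p ρ (0, coordVec d i) (0, coordVec d j))
    (Matrix.of fun i j => -secondDeriv p ρ (coordVec d i, 0) (coordVec d j, 0))
    (Matrix.of fun i j => -secondDeriv p ρ (coordVec d i, 0) (0, coordVec d j))

/-- `ρ` is a singular point of the characteristic variety `p = 0`. -/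
def IsSingularPoint {d : ℕ} (p : TXsp d × TXsp d → ℝ) (ρ : TXsp d × TXsp d) : Prop :=
  p ρ = 0 ∧ fderiv ℝ p ρ = 0

/-- `ρ` is an effectively hyperbolic singular point of `p = 0`: the Hamilton map there has a pair
`±μ` of non-zero real eigenvalues. -/
def IsEffectivelyHyperbolic {d : ℕ} (p : TXsp d × TXsp d → ℝ) (ρ : TXsp d × TXsp d) : Prop :=
  IsSingularPoint p ρ ∧
    ∃ μ : ℝ, μ ≠ 0 ∧
      Module.End.HasEigenvalue (Matrix.toLin' (hamiltonMap p ρ)) μ ∧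
      Module.End.HasEigenvalue (Matrix.toLin' (hamiltonMap p ρ)) (-μ)

/-- The symbol `p₂(t, x, τ, ξ) = τ² - a(t, x, ξ) |ξ|²`. -/
def secondOrderSymbol {d : ℕ} (a : ℝ × Esp d × Esp d → ℝ) : TXsp d × TXsp d → ℝ :=
  fun ρ => ρ.2.1 ^ 2 - a (ρ.1.1, ρ.1.2, ρ.2.2) * ‖ρ.2.2‖ ^ 2

/-- `V` is a conic neighbourhood of `(x₀, η)` in `ℝᵈ × (ℝᵈ ∖ {0})`. -/
def IsConicNhd {d : ℕ} (V : Set (Esp d × Esp d)) (x₀ η : Esp d) : Prop :=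
  IsOpen V ∧ (x₀, η) ∈ V ∧
    ∀ x ξ, (x, ξ) ∈ V → ξ ≠ 0 ∧ ∀ s : ℝ, 0 < s → (x, s • ξ) ∈ V

/-- `W` is a conic neighbourhood of `(t₀, x₀, η)` in `ℝ × ℝᵈ × (ℝᵈ ∖ {0})`. -/
def IsConicNhdT {d : ℕ} (W : Set (ℝ × Esp d × Esp d)) (t₀ : ℝ) (x₀ η : Esp d) : Prop :=
  IsOpen W ∧ (t₀, x₀, η) ∈ W ∧
    ∀ t x ξ, (t, x, ξ) ∈ W → ξ ≠ 0 ∧ ∀ s : ℝ, 0 < s → (t, x, s • ξ) ∈ W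

/-- The Poisson bracket `{f, g} = ∑ⱼ (∂f/∂ξⱼ ∂g/∂xⱼ - ∂f/∂xⱼ ∂g/∂ξⱼ)`. -/
def poissonBracket {d : ℕ} (f g : Esp d × Esp d → ℝ) (z : Esp d × Esp d) : ℝ :=
  ∑ j : Fin d,
    (fderiv ℝ f z (0, EuclideanSpace.single j 1) * fderiv ℝ g z (EuclideanSpace.single j 1, 0) -
      fderiv ℝ f z (EuclideanSpace.single j 1, 0) * fderiv ℝ g z (0, EuclideanSpace.single j 1))

/-- The mixed partial derivative `∂_{x_{i 0}} ⋯ ∂_{x_{i (k-1)}} ∂_{ξ_{j 0}} ⋯ ∂_{ξ_{j (l-1)}} ψ`.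
Every `∂_x^α ∂_ξ^β` with `|α| = k`, `|β| = l` is of this form. -/
def mixedPartial {d k l : ℕ} (ψ : Esp d × Esp d → ℝ) (i : Fin k → Fin d) (j : Fin l → Fin d)
    (z : Esp d × Esp d) : ℝ :=
  iteratedFDeriv ℝ (k + l) ψ z
    (Fin.append (fun m => ((EuclideanSpace.single (i m) 1, 0) : Esp d × Esp d))
      (fun m => ((0, EuclideanSpace.single (j m) 1) : Esp d × Esp d)))

/-- The symbol estimates of order `0` on `V` (for `|ξ| ≥ 1`):
`|∂_x^α ∂_ξ^β ψ(x, ξ)| ≤ C_{αβ} ⟨ξ⟩^{-|β|}` with `⟨ξ⟩ = (1 + |ξ|²)^{1/2}`. -/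
def HasSymbolBounds {d : ℕ} (ψ : Esp d × Esp d → ℝ) (V : Set (Esp d × Esp d)) : Prop :=
  ∀ (k l : ℕ) (i : Fin k → Fin d) (j : Fin l → Fin d),
    ∃ C : ℝ, ∀ x ξ, (x, ξ) ∈ V → 1 ≤ ‖ξ‖ →
      |mixedPartial ψ i j (x, ξ)| ≤ C / Real.sqrt (1 + ‖ξ‖ ^ 2) ^ l

end

/-! Write `B = |η|² a''(0, 0, η)` and `ω` for the symplectic form on `(x, ξ)`. Since `a` and `da`
vanish at the point and `a ≥ 0` for `t ≥ 0`, `B` is nonnegative on the half-space `t ≥ 0`, hence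
everywhere because a quadratic form is even. Eigenvectors of the Hamilton map for `±μ` have non-zero
time component and can be scaled to time component `1`. Half their sum gives a vector `(1, y)`,
their difference divided by `μ` a vector `(0, z)`, with `B(u, (1, y)) = m (u_t - ω(u', z))` and `m >
0`. Positivity of `B` on `(1, y)` amounts to `B((0, z), (0, z)) < 2` (`exists_spacelike_direction`).

The phase is the solution `t = ψ` of `∂_{(1,y)} a = 0`. The formula for `B(u, (1, y))` makes the
implicit function theorem applicable and gives `dψ = ω(·, z)`, so that the Hamilton field of `ψ` at
the base point is `z`, and `{ψ, a}` is the derivative of `a` along that field.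

Both inequalities then follow from a one-sided Glaeser inequality (`fderiv_sq_le_of_nonneg`). Along
the Hamilton field `t` is fixed, so nonnegativity for `t ≥ 0` is enough, and `B((0, z), (0, z)) < 2`
yields `κ < 1`. Along `(1, y)` the optimal step may leave `t ≥ 0`: if it does not, `a` dominates
`(∂_{(1,y)} a)²`, hence `(t - ψ)²`; if it does, stopping at `t = 0` gives `a ≳ t²`. This dichotomy
is the minimum in the statement (`exists_local_estimate`).

Homogeneity is restored by composing with the projection to `|ξ| = |η|`, which leaves `dψ` at the
base point unchanged because the radial direction lies in the radical of `B`. -/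

noncomputable section

/-! ### The Hamilton map and its eigenvectors -/

/-- The phase-space vector with the given coordinates. -/
def phaseVec {d : ℕ} (v : (Unit ⊕ Fin d) ⊕ (Unit ⊕ Fin d) → ℝ) : TXsp d × TXsp d :=
  (((v (.inl (.inl ()))), WithLp.toLp 2 fun j => v (.inl (.inr j))),
    ((v (.inr (.inl ()))), WithLp.toLp 2 fun j => v (.inr (.inr j))))

theorem euclidean_eq_sum_single {d : ℕ} (x : Esp d) :
    x = ∑ j, x j • (EuclideanSpace.single j (1 : ℝ) : Esp d) := by
  ext i
  simp [Finset.sum_apply, Pi.single_apply]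

theorem txsp_eq_sum_coordVec {d : ℕ} (X : TXsp d) :
    X = X.1 • coordVec d (.inl ()) + ∑ j, X.2 j • coordVec d (.inr j) := by
  apply Prod.ext
  · simp [coordVec, Prod.fst_sum]
  · simp only [coordVec, Sum.elim_inl, Sum.elim_inr, Prod.snd_add, Prod.smul_snd, smul_zero,
      zero_add, Prod.snd_sum]
    exact euclidean_eq_sum_single X.2

theorem phaseVec_eq_sum {d : ℕ} (v : (Unit ⊕ Fin d) ⊕ (Unit ⊕ Fin d) → ℝ) :
    phaseVec v = ∑ j, v (.inl j) • ((coordVec d j, 0) : TXsp d × TXsp d) +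
      ∑ j, v (.inr j) • ((0, coordVec d j) : TXsp d × TXsp d) := by
  apply Prod.ext
  · simp only [Prod.fst_add, Prod.fst_sum, Prod.smul_fst, smul_zero, Finset.sum_const_zero,
      add_zero]
    rw [txsp_eq_sum_coordVec (phaseVec v).1]
    simp [phaseVec]
  · simp only [Prod.snd_add, Prod.snd_sum, Prod.smul_snd, smul_zero, Finset.sum_const_zero,
      zero_add]
    rw [txsp_eq_sum_coordVec (phaseVec v).2]
    simp [phaseVec]

theorem hamiltonMap_mulVec_inl {d : ℕ} (p : TXsp d × TXsp d → ℝ) (ρ : TXsp d × TXsp d)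
    (v : (Unit ⊕ Fin d) ⊕ (Unit ⊕ Fin d) → ℝ) (i : Unit ⊕ Fin d) :
    (hamiltonMap p ρ).mulVec v (.inl i) = secondDeriv p ρ (0, coordVec d i) (phaseVec v) := by
  rw [phaseVec_eq_sum]
  simp only [Matrix.mulVec, dotProduct, hamiltonMap, secondDeriv, map_add, map_sum, map_smul,
    smul_eq_mul, Fintype.sum_sum_type (α₁ := Unit ⊕ Fin d), Matrix.fromBlocks_apply₁₁,
    Matrix.fromBlocks_apply₁₂, Matrix.of_apply, mul_comm]

theorem hamiltonMap_mulVec_inr {d : ℕ} (p : TXsp d × TXsp d → ℝ) (ρ : TXsp d × TXsp d)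
    (v : (Unit ⊕ Fin d) ⊕ (Unit ⊕ Fin d) → ℝ) (i : Unit ⊕ Fin d) :
    (hamiltonMap p ρ).mulVec v (.inr i) = -secondDeriv p ρ (coordVec d i, 0) (phaseVec v) := by
  rw [phaseVec_eq_sum]
  simp only [Matrix.mulVec, dotProduct, hamiltonMap, secondDeriv, map_add, map_sum, map_smul,
    smul_eq_mul, Fintype.sum_sum_type (α₁ := Unit ⊕ Fin d), Matrix.fromBlocks_apply₂₁,
    Matrix.fromBlocks_apply₂₂, Matrix.of_apply, neg_mul, Finset.sum_neg_distrib, neg_add]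
  simp only [mul_comm]

/-- An eigenvector `V` of the Hamilton map satisfies `p''(U, V) = s σ(U, V)` for every `U`. -/
theorem exists_secondDeriv_eq_of_hasEigenvalue {d : ℕ} {p : TXsp d × TXsp d → ℝ}
    {ρ : TXsp d × TXsp d} {s : ℝ}
    (h : Module.End.HasEigenvalue (Matrix.toLin' (hamiltonMap p ρ)) s) :
    ∃ V : TXsp d × TXsp d, V ≠ 0 ∧ ∀ U : TXsp d × TXsp d,
      secondDeriv p ρ U V = s * (U.2.1 * V.1.1 + inner ℝ U.2.2 V.1.2
        - U.1.1 * V.2.1 - inner ℝ U.1.2 V.2.2) := by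
  obtain ⟨v, hv⟩ := h.exists_hasEigenvector
  have hv0 := hv.2
  have hv1 : (hamiltonMap p ρ).mulVec v = s • v := by
    simpa [Matrix.toLin'_apply] using hv.apply_eq_smul
  refine ⟨phaseVec v, ?_, fun U => ?_⟩
  · intro h0
    apply hv0
    have h1 := congrArg Prod.fst h0
    have h2 := congrArg Prod.snd h0
    funext i
    rcases i with (i | i) | (i | i)
    · exact congrArg Prod.fst h1
    · exact congrArg (fun X : TXsp d => X.2 i) h1
    · exact congrArg Prod.fst h2
    · exact congrArg (fun X : TXsp d => X.2 i) h2
  · have e1 : ∀ i, secondDeriv p ρ (0, coordVec d i) (phaseVec v) = s * v (.inl i) := fun i => by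
      rw [← hamiltonMap_mulVec_inl, hv1]; rfl
    have e2 : ∀ i, secondDeriv p ρ (coordVec d i, 0) (phaseVec v) = -(s * v (.inr i)) :=
      fun i => by
      rw [eq_neg_iff_add_eq_zero, ← neg_eq_iff_add_eq_zero, ← hamiltonMap_mulVec_inr, hv1]; rfl
    have hU : U = (U.1.1 • ((coordVec d (.inl ()), 0) : TXsp d × TXsp d) +
        ∑ j, U.1.2 j • ((coordVec d (.inr j), 0) : TXsp d × TXsp d)) +
        (U.2.1 • ((0, coordVec d (.inl ())) : TXsp d × TXsp d) +
        ∑ j, U.2.2 j • ((0, coordVec d (.inr j)) : TXsp d × TXsp d)) := by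
      apply Prod.ext
      · simpa [Prod.fst_sum] using txsp_eq_sum_coordVec U.1
      · simpa [Prod.snd_sum] using txsp_eq_sum_coordVec U.2
    unfold secondDeriv at e1 e2 ⊢
    conv_lhs => rw [hU]
    simp only [map_add, map_sum, map_smul, add_apply,
      sum_apply, smul_apply, smul_eq_mul, e1, e2]
    simp only [PiLp.inner_apply, phaseVec, RCLike.inner_apply, conj_trivial]
    have r1 : ∑ j, U.1.2 j * -(s * v (.inr (.inr j))) = -(s * ∑ j, v (.inr (.inr j)) * U.1.2 j) := by
      rw [Finset.mul_sum, ← Finset.sum_neg_distrib]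
      exact Finset.sum_congr rfl fun j _ => by ring
    have r2 : ∑ j, U.2.2 j * (s * v (.inl (.inr j))) = s * ∑ j, v (.inl (.inr j)) * U.2.2 j := by
      rw [Finset.mul_sum]
      exact Finset.sum_congr rfl fun j _ => by ring
    rw [r1, r2]
    ring

/-! ### Symplectic linear algebra of effective hyperbolicity -/

/-- The symplectic form of `ℝᵈ × ℝᵈ`, with the sign for which `ω((x, ξ), (y, ζ)) = ξ·y - x·ζ`. -/
def symplForm {d : ℕ} (w z : Esp d × Esp d) : ℝ := inner ℝ w.2 z.1 - inner ℝ w.1 z.2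

theorem eq_zero_of_symplForm {d : ℕ} {z : Esp d × Esp d} (h : ∀ w, symplForm w z = 0) :
    z = 0 := by
  have h1 := h (0, z.1)
  have h2 := h (z.2, 0)
  simp only [symplForm, inner_zero_left, sub_zero, zero_sub, neg_eq_zero,
    inner_self_eq_zero] at h1 h2
  exact Prod.ext h1 h2

theorem symplForm_self {d : ℕ} (w : Esp d × Esp d) : symplForm w w = 0 := by
  simp [symplForm, real_inner_comm]

theorem symplForm_smul_right {d : ℕ} (w z : Esp d × Esp d) (c : ℝ) :
    symplForm w (c • z) = c * symplForm w z := by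
  simp [symplForm, inner_smul_right]; ring

theorem symplForm_sub_right {d : ℕ} (w y z : Esp d × Esp d) :
    symplForm w (y - z) = symplForm w y - symplForm w z := by
  simp [symplForm, inner_sub_right]; ring

/-- Cauchy–Schwarz for a positive semidefinite symmetric bilinear form: isotropic vectors are
in the radical. -/
theorem apply_eq_zero_of_isotropic {F : Type*} [NormedAddCommGroup F] [NormedSpace ℝ F]
    {B : F →L[ℝ] F →L[ℝ] ℝ} (hsymm : ∀ u v, B u v = B v u) (hpos : ∀ u, 0 ≤ B u u) {v : F}
    (hv : B v v = 0) (u : F) : B u v = 0 := by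
  -- As `B v v = 0`, the form at `u + r v` is affine in `r`; being nonnegative for all `r`, it has
  -- slope zero.
  have key : ∀ r : ℝ, 0 ≤ B u u + 2 * r * B u v := fun r => by
    have := hpos (u + r • v)
    simp only [map_add, map_smul, add_apply, smul_apply,
      smul_eq_mul, hv, hsymm v u] at this
    linarith
  by_contra h
  have := key (-(B u u + 1) / (2 * B u v))
  have e : 2 * (-(B u u + 1) / (2 * B u v)) * B u v = -(B u u + 1) := by field_simp
  linarith

/-- The linear algebra of effective hyperbolicity for `τ² - B(u, u)/2`: the sum and the difference
of eigenvectors for `±μ`. -/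
theorem exists_spacelike_direction {d : ℕ}
    {B : (ℝ × Esp d × Esp d) →L[ℝ] (ℝ × Esp d × Esp d) →L[ℝ] ℝ}
    (hsymm : ∀ u v, B u v = B v u) (hpos : ∀ u, 0 ≤ B u u) {μ : ℝ} (hμ : μ ≠ 0)
    (heig : ∀ s : ℝ, s = μ ∨ s = -μ → ∃ V : TXsp d × TXsp d, V ≠ 0 ∧ ∀ U : TXsp d × TXsp d,
      2 * U.2.1 * V.2.1 - B (U.1.1, U.1.2, U.2.2) (V.1.1, V.1.2, V.2.2) =
        s * (U.2.1 * V.1.1 + inner ℝ U.2.2 V.1.2 - U.1.1 * V.2.1 - inner ℝ U.1.2 V.2.2)) :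
    ∃ (y z : Esp d × Esp d) (m : ℝ), 0 < m ∧
      (∀ u, B u (1, y) = m * (u.1 - symplForm u.2 z)) ∧ B (0, z) (0, z) < 2 := by
  have norm : ∀ s : ℝ, s = μ ∨ s = -μ → ∃ w : Esp d × Esp d,
      ∀ u, B u (1, w) = s ^ 2 / 2 * u.1 - s * symplForm u.2 w := by
    intro s hs
    have hs0 : s ≠ 0 := by rcases hs with rfl | rfl <;> simpa using hμ
    obtain ⟨V, hV0, hV⟩ := heig s hs
    -- The eigenvalue equation tested against the pure `τ` direction.
    have hτ : V.2.1 = s * V.1.1 / 2 := by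
      have := hV (0, (1, 0))
      simp only [Prod.fst_zero, Prod.snd_zero, inner_zero_left] at this
      have e : ((0 : ℝ), (0 : Esp d), (0 : Esp d)) = 0 := rfl
      rw [e] at this
      simp at this
      linarith
    have hB : ∀ u : ℝ × Esp d × Esp d, B u (V.1.1, V.1.2, V.2.2) =
        s ^ 2 / 2 * V.1.1 * u.1 - s * symplForm u.2 (V.1.2, V.2.2) := fun u => by
      have := hV ((u.1, u.2.1), (0, u.2.2))
      simp only [hτ] at this
      simp only [symplForm]
      linarith
    -- With zero time component, the `(t, x, ξ)` part of `V` would be isotropic, hence in the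
    -- radical of `B`. As `s ≠ 0`, its `(x, ξ)` part would be `ω`-orthogonal to everything, forcing
    -- `V = 0`.
    have ht : V.1.1 ≠ 0 := by
      intro ht
      have h0 : B (V.1.1, V.1.2, V.2.2) (V.1.1, V.1.2, V.2.2) = 0 := by
        rw [hB]; simp [ht, symplForm_self]
      have hz : ((V.1.2, V.2.2) : Esp d × Esp d) = 0 := by
        apply eq_zero_of_symplForm
        intro w
        have h1 := apply_eq_zero_of_isotropic hsymm hpos h0 (0, w)
        rw [hB] at h1
        simpa [hs0] using h1
      apply hV0
      have hz1 := congrArg Prod.fst hz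
      have hz2 := congrArg Prod.snd hz
      simp only [Prod.fst_zero, Prod.snd_zero] at hz1 hz2
      exact Prod.ext (Prod.ext ht hz1) (Prod.ext (by simp [hτ, ht]) hz2)
    refine ⟨V.1.1⁻¹ • (V.1.2, V.2.2), fun u => ?_⟩
    have e : ((1 : ℝ), V.1.1⁻¹ • ((V.1.2, V.2.2) : Esp d × Esp d)) =
        V.1.1⁻¹ • (V.1.1, V.1.2, V.2.2) := by
      apply Prod.ext
      · simp [ht]
      · rfl
    rw [e, map_smul, hB, symplForm_smul_right, smul_eq_mul]
    field_simp
  obtain ⟨wp, hp⟩ := norm μ (Or.inl rfl)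
  obtain ⟨wm, hm⟩ := norm (-μ) (Or.inr rfl)
  have hμ2 : 0 < μ ^ 2 := by positivity
  have hY : ((1 : ℝ), (1 / 2 : ℝ) • (wp + wm)) =
      (1 / 2 : ℝ) • (((1 : ℝ), wp) + ((1 : ℝ), wm)) := by
    apply Prod.ext
    · norm_num
    · rfl
  have hZ : ((0 : ℝ), μ⁻¹ • (wp - wm)) = μ⁻¹ • (((1 : ℝ), wp) - ((1 : ℝ), wm)) := by
    apply Prod.ext
    · simp
    · rfl
  have hYu : ∀ u, B u (1, (1 / 2 : ℝ) • (wp + wm)) =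
      μ ^ 2 / 2 * (u.1 - symplForm u.2 (μ⁻¹ • (wp - wm))) := fun u => by
    rw [hY, map_smul, map_add, hp, hm, symplForm_smul_right, symplForm_sub_right, smul_eq_mul]
    field_simp
    ring
  refine ⟨(1 / 2 : ℝ) • (wp + wm), μ⁻¹ • (wp - wm), μ ^ 2 / 2, by positivity, hYu, ?_⟩
  have hpp := hp (1, wp)
  have hmm := hm (1, wm)
  simp only [symplForm_self] at hpp hmm
  -- An isotropic `(1, y)` would lie in the radical, yet its pairing with `(1, 0)` is `μ² / 2`.
  have hYpos : 0 < B (1, (1 / 2 : ℝ) • (wp + wm)) (1, (1 / 2 : ℝ) • (wp + wm)) := by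
    refine lt_of_le_of_ne (hpos _) fun h => ?_
    have h1 := apply_eq_zero_of_isotropic hsymm hpos h.symm (1, 0)
    rw [hYu] at h1
    simp [symplForm, hμ] at h1
  rw [hY] at hYpos
  rw [hZ]
  simp only [map_add, map_sub, map_smul, add_apply,
    sub_apply, smul_apply, smul_eq_mul, hpp, hmm,
    hsymm (1, wm) (1, wp)] at hYpos ⊢
  -- With `b = B (1, wp) (1, wm)`, the sum vector has square `μ² / 4 + b / 2` and the difference
  -- vector `(μ² - 2b) / μ²`: positivity of the first is exactly the bound `2` on the second.
  have h3 : -(μ ^ 2 / 2) < B (1, wp) (1, wm) := by linarith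
  have : μ⁻¹ * (μ⁻¹ * (μ ^ 2 / 2 * 1 - μ * 0 - B (1, wp) (1, wm)) -
      μ⁻¹ * (B (1, wp) (1, wm) - ((-μ) ^ 2 / 2 * 1 - -μ * 0))) =
      (μ ^ 2 - 2 * B (1, wp) (1, wm)) / μ ^ 2 := by
    field_simp
    ring
  rw [this, div_lt_iff₀ hμ2]
  linarith

/-! ### Taylor and Glaeser inequalities, implicit functions -/

open Set Filter Topology in
/-- Second order Taylor upper bound on a convex set. -/
theorem apply_add_le_of_secondDeriv_le {F : Type*} [NormedAddCommGroup F] [NormedSpace ℝ F]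
    {f : F → ℝ} {D : Set F} (hD : Convex ℝ D) (hf : ∀ x ∈ D, ContDiffAt ℝ 2 f x) {M : ℝ} {u : F}
    (hM : ∀ x ∈ D, fderiv ℝ (fderiv ℝ f) x u u ≤ M) {y : F} (hy : y ∈ D) (hyu : y + u ∈ D) :
    f (y + u) ≤ f y + fderiv ℝ f y u + M / 2 := by
  have hmem : ∀ r ∈ Icc (0 : ℝ) 1, y + r • u ∈ D := fun r hr =>
    hD.add_smul_mem hy hyu hr
  have hline : ∀ r : ℝ, HasDerivAt (fun r : ℝ => y + r • u) u r := fun r => by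
    simpa using ((hasDerivAt_id r).smul_const u).const_add y
  have h1 : ∀ r ∈ Icc (0 : ℝ) 1,
      HasDerivAt (fun r : ℝ => f (y + r • u)) (fderiv ℝ f (y + r • u) u) r := fun r hr =>
    ((hf _ (hmem r hr)).differentiableAt (by norm_num)).hasFDerivAt.comp_hasDerivAt r (hline r)
  have h2 : ∀ r ∈ Icc (0 : ℝ) 1, HasDerivAt (fun r : ℝ => fderiv ℝ f (y + r • u) u)
      (fderiv ℝ (fderiv ℝ f) (y + r • u) u u) r := fun r hr => by
    have h3 : DifferentiableAt ℝ (fderiv ℝ f) (y + r • u) :=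
      ((hf _ (hmem r hr)).fderiv_right (m := 1) (by norm_num)).differentiableAt (by norm_num)
    have h4 := h3.hasFDerivAt.comp_hasDerivAt r (hline r)
    simpa using h4.clm_apply (hasDerivAt_const r u)
  have b1 : ∀ r ∈ Icc (0 : ℝ) 1, fderiv ℝ f (y + r • u) u ≤ fderiv ℝ f y u + M * r := by
    intro r hr
    refine image_le_of_deriv_right_le_deriv_boundary (a := 0) (b := 1)
      (f := fun r : ℝ => fderiv ℝ f (y + r • u) u)
      (f' := fun r => fderiv ℝ (fderiv ℝ f) (y + r • u) u u)
      (B := fun r => fderiv ℝ f y u + M * r) (B' := fun _ => M)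
      (fun x hx => (h2 x hx).continuousAt.continuousWithinAt)
      (fun x hx => (h2 x (Ico_subset_Icc_self hx)).hasDerivWithinAt)
      (by simp) (by fun_prop) (fun x _ => ?_)
      (fun x hx => hM _ (hmem x (Ico_subset_Icc_self hx))) hr
    simpa using (((hasDerivAt_id x).const_mul M).const_add (fderiv ℝ f y u)).hasDerivWithinAt
  have b2 := image_le_of_deriv_right_le_deriv_boundary (a := 0) (b := 1)
      (f := fun r : ℝ => f (y + r • u)) (f' := fun r => fderiv ℝ f (y + r • u) u)
      (B := fun r => f y + fderiv ℝ f y u * r + M / 2 * r ^ 2)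
      (B' := fun r => fderiv ℝ f y u + M * r)
      (fun x hx => (h1 x hx).continuousAt.continuousWithinAt)
      (fun x hx => (h1 x (Ico_subset_Icc_self hx)).hasDerivWithinAt)
      (by simp) (by fun_prop) (fun x _ => ?_)
      (fun x hx => b1 x (Ico_subset_Icc_self hx)) (x := 1) (by simp)
  · simpa using b2
  · have h5 := (((hasDerivAt_id x).const_mul (fderiv ℝ f y u)).const_add (f y)).add
      (((hasDerivAt_id x).pow 2).const_mul (M / 2))
    refine (h5.congr_deriv ?_).hasDerivWithinAt
    simp
    ring

/-- The one-sided Glaeser inequality: `f ≥ 0` at the optimal point of the segment. -/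
theorem fderiv_sq_le_of_nonneg {F : Type*} [NormedAddCommGroup F] [NormedSpace ℝ F]
    {f : F → ℝ} {D : Set F} (hD : Convex ℝ D) (hf : ∀ x ∈ D, ContDiffAt ℝ 2 f x) {M : ℝ}
    (hM0 : 0 < M) {u : F} (hM : ∀ x ∈ D, fderiv ℝ (fderiv ℝ f) x u u ≤ M) {y : F} (hy : y ∈ D)
    (hyu : y + (-(fderiv ℝ f y u / M)) • u ∈ D)
    (hpos : 0 ≤ f (y + (-(fderiv ℝ f y u / M)) • u)) :
    fderiv ℝ f y u ^ 2 ≤ 2 * M * f y := by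
  -- The minimiser of the quadratic majorant `f y + s f'(y)u + s² M / 2`.
  set s := -(fderiv ℝ f y u / M) with hs
  have h := apply_add_le_of_secondDeriv_le hD hf (u := s • u) (M := s ^ 2 * M)
    (fun x hx => by
      simp only [map_smul, smul_apply, smul_eq_mul]
      rw [← mul_assoc, ← sq]
      exact mul_le_mul_of_nonneg_left (hM x hx) (sq_nonneg s)) hy hyu
  rw [map_smul, smul_eq_mul] at h
  have e : s * fderiv ℝ f y u + s ^ 2 * M / 2 = -(fderiv ℝ f y u ^ 2 / (2 * M)) := by
    rw [hs]; field_simp; ring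
  have h3 : fderiv ℝ f y u ^ 2 / (2 * M) ≤ f y := by linarith
  rw [div_le_iff₀ (by positivity)] at h3
  linarith

open Set Filter Topology in
/-- Second order necessary condition at a critical zero, one-sided in the direction `u`. -/
theorem secondDeriv_nonneg_of_eventually_nonneg {F : Type*} [NormedAddCommGroup F]
    [NormedSpace ℝ F] {f : F → ℝ} {x₀ : F} (hf : ContDiffAt ℝ 2 f x₀) (h0 : f x₀ = 0)
    (h1 : fderiv ℝ f x₀ = 0) {u : F} (hpos : ∀ᶠ s : ℝ in 𝓝[>] 0, 0 ≤ f (x₀ + s • u)) :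
    0 ≤ fderiv ℝ (fderiv ℝ f) x₀ u u := by
  by_contra! hneg
  obtain ⟨m, hm1, hm0⟩ := exists_between hneg
  have hc : ContinuousAt (fun x => fderiv ℝ (fderiv ℝ f) x u u) x₀ := by
    have h2 : ContinuousAt (fderiv ℝ (fderiv ℝ f)) x₀ :=
      ((hf.fderiv_right (m := 1) (by norm_num)).fderiv_right (m := 0) (by norm_num)).continuousAt
    exact (h2.clm_apply continuousAt_const).clm_apply continuousAt_const
  obtain ⟨r, hr, hball⟩ := Metric.eventually_nhds_iff_ball.1
    ((hc.eventually (gt_mem_nhds hm1)).and (hf.eventually (by norm_num)))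
  have hlim : Tendsto (fun s : ℝ => x₀ + s • u) (𝓝[>] 0) (𝓝 x₀) := by
    have : Continuous (fun s : ℝ => x₀ + s • u) := by fun_prop
    simpa using (this.tendsto 0).mono_left nhdsWithin_le_nhds
  obtain ⟨s, ⟨hs1, hs2⟩, hs0⟩ := ((hpos.and
    (hlim.eventually (Metric.ball_mem_nhds x₀ hr))).and self_mem_nhdsWithin).exists
  have hs0' : (0 : ℝ) < s := hs0
  have h := apply_add_le_of_secondDeriv_le (convex_ball x₀ r) (fun x hx => (hball x hx).2)
    (u := s • u) (M := s ^ 2 * m) (fun x hx => by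
      simp only [map_smul, smul_apply, smul_eq_mul]
      rw [← mul_assoc, ← sq]
      exact mul_le_mul_of_nonneg_left (hball x hx).1.le (sq_nonneg s))
    (Metric.mem_ball_self hr) hs2
  rw [h0, h1] at h
  simp only [zero_apply, add_zero, zero_add] at h
  have : s ^ 2 * m < 0 := mul_neg_of_pos_of_neg (by positivity) hm0
  linarith

open Set Filter Topology in
/-- The implicit function theorem for a scalar equation `Φ(t, w) = 0`, with a solution `t = ψ(w)`
that is smooth on a whole neighbourhood. -/
theorem exists_implicit_solution {E : Type*} [NormedAddCommGroup E] [NormedSpace ℝ E]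
    [CompleteSpace E] {Φ : ℝ × E → ℝ} {O : Set (ℝ × E)} (hO : IsOpen O)
    (hΦ : ContDiffOn ℝ ∞ Φ O) {t₀ : ℝ} {w₀ : E} (h0 : (t₀, w₀) ∈ O) (hz : Φ (t₀, w₀) = 0)
    (hd : ∀ y ∈ O, fderiv ℝ Φ y (1, 0) ≠ 0) :
    ∃ (ψ : E → ℝ) (U : Set E), IsOpen U ∧ w₀ ∈ U ∧ ψ w₀ = t₀ ∧ ContDiffOn ℝ ∞ ψ U ∧
      ∀ w ∈ U, (ψ w, w) ∈ O ∧ Φ (ψ w, w) = 0 := by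
  have hsm : ∀ y ∈ O, ContDiffAt ℝ ∞ Φ y := fun y hy => hΦ.contDiffAt (hO.mem_nhds hy)
  -- `G` straightens the zero set of `Φ`. Its derivative is invertible at every point of `O`, so its
  -- local inverse is smooth on a whole neighbourhood and not only at the base point.
  let G : ℝ × E → ℝ × E := fun y => (Φ y, y.2)
  have hG : ∀ y ∈ O, ContDiffAt ℝ ∞ G y := fun y hy => (hsm y hy).prodMk contDiffAt_snd
  have hG' : ∀ y ∈ O, ∃ e : (ℝ × E) ≃L[ℝ] (ℝ × E),
      HasFDerivAt G (e : (ℝ × E) →L[ℝ] (ℝ × E)) y := by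
    intro y hy
    set L := fderiv ℝ Φ y with hL
    have hc : L (1, 0) ≠ 0 := hd y hy
    have hsplit : ∀ q : ℝ × E, L q = q.1 * L (1, 0) + L (0, q.2) := fun q => by
      conv_lhs => rw [show q = q.1 • ((1 : ℝ), (0 : E)) + (0, q.2) by ext <;> simp]
      rw [map_add, map_smul, smul_eq_mul]
    let A : (ℝ × E) →L[ℝ] (ℝ × E) := L.prod (ContinuousLinearMap.snd ℝ ℝ E)
    let A' : (ℝ × E) →L[ℝ] (ℝ × E) :=
      ((L (1, 0))⁻¹ • (ContinuousLinearMap.fst ℝ ℝ E -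
        L.comp ((ContinuousLinearMap.inr ℝ ℝ E).comp (ContinuousLinearMap.snd ℝ ℝ E)))).prod
        (ContinuousLinearMap.snd ℝ ℝ E)
    refine ⟨ContinuousLinearEquiv.equivOfInverse A A' (fun q => ?_) (fun q => ?_), ?_⟩
    · apply Prod.ext
      · simp [A, A', hsplit q]
        field_simp
      · simp [A, A']
    · apply Prod.ext
      · simp only [A, A', ContinuousLinearMap.prod_apply]
        rw [hsplit]
        simp
        field_simp
        ring
      · simp [A, A']
    · exact ((hsm y hy).differentiableAt (by simp)).hasFDerivAt.prodMk hasFDerivAt_snd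
  obtain ⟨e₀, he₀⟩ := hG' _ h0
  let h := (hG _ h0).toOpenPartialHomeomorph G he₀ (by simp)
  have hsrc : (t₀, w₀) ∈ h.source := (hG _ h0).mem_toOpenPartialHomeomorph_source he₀ (by simp)
  have hcoe : ∀ y, h y = G y := fun y => rfl
  have hG0 : G (t₀, w₀) = (0, w₀) := by simp [G, hz]
  have hT : IsOpen (h.target ∩ h.symm ⁻¹' O) := h.isOpen_inter_preimage_symm hO
  have hsymm0 : h.symm (0, w₀) = (t₀, w₀) := by rw [← hG0, ← hcoe, h.left_inv hsrc]
  refine ⟨fun w => (h.symm (0, w)).1, {w | (0, w) ∈ h.target ∩ h.symm ⁻¹' O}, ?_, ?_, ?_, ?_, ?_⟩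
  · exact hT.preimage (by fun_prop : Continuous fun w : E => ((0 : ℝ), w))
  · refine ⟨?_, ?_⟩
    · rw [← hG0, ← hcoe]; exact h.map_source hsrc
    · change h.symm (0, w₀) ∈ O
      rw [hsymm0]; exact h0
  · simp [hsymm0]
  · intro w hw
    obtain ⟨e, he⟩ := hG' _ hw.2
    have h1 : ContDiffAt ℝ ∞ h.symm (0, w) := h.contDiffAt_symm hw.1 he (hG _ hw.2)
    have h2 : ContDiffAt ℝ ∞ (fun w : E => ((0 : ℝ), w)) w := by fun_prop
    exact (h1.comp w h2).fst.contDiffWithinAt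
  · intro w hw
    have h1 : G (h.symm (0, w)) = (0, w) := h.right_inv hw.1
    have h2 : (h.symm (0, w)).2 = w := congrArg Prod.snd h1
    have h3 : ((h.symm (0, w)).1, w) = h.symm (0, w) := by
      exact Prod.ext rfl h2.symm
    refine ⟨?_, ?_⟩
    · simp only [h3]; exact hw.2
    · simp only [h3]; exact congrArg Prod.fst h1

open Set Filter Topology in
/-- If `∂ₜΦ ≥ m` on a convex set, `Φ` grows at least linearly in `t`. -/
theorem mul_abs_sub_le_of_le_fderiv {E : Type*} [NormedAddCommGroup E] [NormedSpace ℝ E]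
    {Φ : ℝ × E → ℝ} {D : Set (ℝ × E)} (hD : Convex ℝ D)
    (hΦ : ∀ y ∈ D, DifferentiableAt ℝ Φ y) {m : ℝ} (hm : ∀ y ∈ D, m ≤ fderiv ℝ Φ y (1, 0))
    {t s : ℝ} {w : E} (ht : (t, w) ∈ D) (hs : (s, w) ∈ D) :
    m * |t - s| ≤ |Φ (t, w) - Φ (s, w)| := by
  wlog hst : s ≤ t generalizing s t
  · rw [abs_sub_comm, abs_sub_comm (Φ _)]
    exact this hs ht (le_of_not_ge hst)
  have hmem : ∀ r ∈ Icc s t, (r, w) ∈ D := by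
    have h1 : Convex ℝ ((fun r : ℝ => (r, w)) ⁻¹' D) := by
      intro r hr r' hr' a b ha hb hab
      have := hD hr hr' ha hb hab
      have e : a • (r, w) + b • (r', w) = (a • r + b • r', w) := by
        apply Prod.ext
        · rfl
        · simp [← add_smul, hab]
      rwa [e] at this
    exact fun r hr => h1.ordConnected.out hs ht hr
  have hd : ∀ r ∈ Icc s t, HasDerivAt (fun r => Φ (r, w)) (fderiv ℝ Φ (r, w) (1, 0)) r :=
    fun r hr => (hΦ _ (hmem r hr)).hasFDerivAt.comp_hasDerivAt r
      ((hasDerivAt_id r).prodMk (hasDerivAt_const r w))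
  have h2 := (convex_Icc s t).mul_sub_le_image_sub_of_le_deriv (f := fun r => Φ (r, w)) (C := m)
    (fun r hr => (hd r hr).continuousAt.continuousWithinAt)
    (fun r hr => (hd r (interior_subset hr)).differentiableAt.differentiableWithinAt)
    (fun r hr => by
      rw [(hd r (interior_subset hr)).deriv]; exact hm _ (hmem r (interior_subset hr)))
    s (left_mem_Icc.2 hst) t (right_mem_Icc.2 hst) hst
  rw [abs_of_nonneg (sub_nonneg.2 hst)]
  exact h2.trans (le_abs_self _)

/-! ### Derivatives of `τ² - a |ξ|²` -/

/-- The projection `(t, x, τ, ξ) ↦ (t, x, ξ)`. -/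
def forgetTau (d : ℕ) : (TXsp d × TXsp d) →L[ℝ] (ℝ × Esp d × Esp d) :=
  ((ContinuousLinearMap.fst ℝ ℝ (Esp d)).comp (ContinuousLinearMap.fst ℝ _ _)).prod
    (((ContinuousLinearMap.snd ℝ ℝ (Esp d)).comp (ContinuousLinearMap.fst ℝ _ _)).prod
      ((ContinuousLinearMap.snd ℝ ℝ (Esp d)).comp (ContinuousLinearMap.snd ℝ _ _)))

theorem forgetTau_apply {d : ℕ} (ρ : TXsp d × TXsp d) :
    forgetTau d ρ = (ρ.1.1, ρ.1.2, ρ.2.2) := rfl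

/-- The projection `(t, x, τ, ξ) ↦ τ`. -/
def projTau (d : ℕ) : (TXsp d × TXsp d) →L[ℝ] ℝ :=
  (ContinuousLinearMap.fst ℝ ℝ (Esp d)).comp (ContinuousLinearMap.snd ℝ _ _)

/-- The projection `(t, x, τ, ξ) ↦ ξ`. -/
def projXi (d : ℕ) : (TXsp d × TXsp d) →L[ℝ] Esp d :=
  (ContinuousLinearMap.snd ℝ ℝ (Esp d)).comp (ContinuousLinearMap.snd ℝ _ _)

theorem fderiv_secondOrderSymbol {d : ℕ} {a : ℝ × Esp d × Esp d → ℝ} {ρ : TXsp d × TXsp d}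
    (ha : DifferentiableAt ℝ a (forgetTau d ρ)) (V : TXsp d × TXsp d) :
    fderiv ℝ (secondOrderSymbol a) ρ V = 2 * ρ.2.1 * V.2.1 -
      (‖ρ.2.2‖ ^ 2 * fderiv ℝ a (forgetTau d ρ) (forgetTau d V) +
        a (forgetTau d ρ) * (2 * inner ℝ ρ.2.2 V.2.2)) := by
  have h1 := (projTau d).hasFDerivAt (x := ρ)
  have h2 := ha.hasFDerivAt.comp ρ (forgetTau d).hasFDerivAt
  have h3 := ((projXi d).hasFDerivAt (x := ρ)).norm_sq
  have h4 := (h1.pow 2).sub (h2.mul h3)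
  have h5 : HasFDerivAt (secondOrderSymbol a) _ ρ := h4
  rw [h5.fderiv]
  simp [projTau, projXi]
  ring

open Filter Topology in
/-- The Hessian of `τ² - a |ξ|²` at a point where `a` and `da` vanish. -/
theorem secondDeriv_secondOrderSymbol {d : ℕ} {a : ℝ × Esp d × Esp d → ℝ} {ρ : TXsp d × TXsp d}
    (ha : ContDiffAt ℝ 2 a (forgetTau d ρ)) (h0 : a (forgetTau d ρ) = 0)
    (h1 : fderiv ℝ a (forgetTau d ρ) = 0) (U V : TXsp d × TXsp d) :
    secondDeriv (secondOrderSymbol a) ρ U V = 2 * U.2.1 * V.2.1 -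
      ‖ρ.2.2‖ ^ 2 * fderiv ℝ (fderiv ℝ a) (forgetTau d ρ) (forgetTau d U) (forgetTau d V) := by
  have hcont : ContDiffAt ℝ 2 (secondOrderSymbol a) ρ := by
    have e1 : ContDiffAt ℝ 2 (fun ρ => a (forgetTau d ρ)) ρ :=
      ha.comp ρ (forgetTau d).contDiff.contDiffAt
    have e2 : ContDiffAt ℝ 2 (fun ρ => ‖projXi d ρ‖ ^ 2) ρ :=
      (projXi d).contDiff.contDiffAt.norm_sq ℝ
    exact ((projTau d).contDiff.contDiffAt.pow 2).sub (e1.mul e2)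
  have hd : DifferentiableAt ℝ (fderiv ℝ (secondOrderSymbol a)) ρ :=
    (hcont.fderiv_right (m := 1) (by norm_num)).differentiableAt (by norm_num)
  have hda : DifferentiableAt ℝ (fderiv ℝ a) (forgetTau d ρ) :=
    (ha.fderiv_right (m := 1) (by norm_num)).differentiableAt (by norm_num)
  have hev : (fun ρ => fderiv ℝ (secondOrderSymbol a) ρ V) =ᶠ[𝓝 ρ] fun ρ =>
      2 * projTau d ρ * V.2.1 -
      (‖projXi d ρ‖ ^ 2 * fderiv ℝ a (forgetTau d ρ) (forgetTau d V) +
        a (forgetTau d ρ) * (2 * inner ℝ (projXi d ρ) V.2.2)) := by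
    have := (forgetTau d).continuous.continuousAt.eventually (ha.eventually (by norm_num))
    filter_upwards [this] with σ hσ
    exact fderiv_secondOrderSymbol (hσ.differentiableAt (by norm_num)) V
  have hL : HasFDerivAt (fun ρ => fderiv ℝ (secondOrderSymbol a) ρ V) _ ρ :=
    hd.hasFDerivAt.clm_apply (hasFDerivAt_const V ρ)
  have g1 := (((projTau d).hasFDerivAt (x := ρ)).const_mul 2).mul_const V.2.1
  have g2 := ((projXi d).hasFDerivAt (x := ρ)).norm_sq
  have g3 := (hda.hasFDerivAt.comp ρ (forgetTau d).hasFDerivAt).clm_apply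
    (hasFDerivAt_const (forgetTau d V) ρ)
  have g4 := (ha.differentiableAt (by norm_num)).hasFDerivAt.comp ρ (forgetTau d).hasFDerivAt
  have g5 := (((projXi d).hasFDerivAt (x := ρ)).inner ℝ (hasFDerivAt_const V.2.2 ρ)).const_mul 2
  have hR := g1.sub ((g2.mul g3).add (g4.mul g5))
  have key := (hL.congr_of_eventuallyEq hev.symm).unique hR
  have := congrArg (fun L => L U) key
  simp [h0, h1, projTau, projXi] at this
  rw [secondDeriv, this]
  ring

/-- At a singular point of `τ² - a |ξ|²` with `ξ ≠ 0`, `τ = 0`, both `a` and `da` vanish. -/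
theorem IsSingularPoint.apply_eq_zero {d : ℕ} {a : ℝ × Esp d × Esp d → ℝ} {η : Esp d}
    (hη : η ≠ 0) (h : IsSingularPoint (secondOrderSymbol a) ((0, 0), (0, η))) :
    a (0, 0, η) = 0 := by
  have h1 := h.1
  simpa [secondOrderSymbol, hη] using h1

theorem IsSingularPoint.fderiv_eq_zero {d : ℕ} {a : ℝ × Esp d × Esp d → ℝ} {η : Esp d}
    (hη : η ≠ 0) (ha : DifferentiableAt ℝ a (0, 0, η))
    (h : IsSingularPoint (secondOrderSymbol a) ((0, 0), (0, η))) :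
    fderiv ℝ a (0, 0, η) = 0 := by
  refine ContinuousLinearMap.ext fun u => ?_
  have h1 := fderiv_secondOrderSymbol (ρ := ((0, 0), (0, η))) ha ((u.1, u.2.1), (0, u.2.2))
  have h2 : a (forgetTau d ((0, 0), (0, η))) = 0 := h.apply_eq_zero hη
  rw [h.2, h2] at h1
  simp [forgetTau_apply, hη] at h1
  simpa using h1

/-! ### Homogeneity, Hamilton fields and the radial projection -/

/-- The dilation `(x, ξ) ↦ (x, sξ)`. -/
def fiberDilation (d : ℕ) (s : ℝ) (hs : s ≠ 0) : (Esp d × Esp d) ≃L[ℝ] (Esp d × Esp d) :=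
  (ContinuousLinearEquiv.refl ℝ (Esp d)).prodCongr
    (ContinuousLinearEquiv.smulLeft (Units.mk0 s hs))

theorem fiberDilation_apply {d : ℕ} {s : ℝ} (hs : s ≠ 0) (z : Esp d × Esp d) :
    fiberDilation d s hs z = (z.1, s • z.2) := rfl

open Filter Topology in
theorem fderiv_eq_of_fiberDilation_invariant {d : ℕ} {s : ℝ} (hs : s ≠ 0)
    {f : Esp d × Esp d → ℝ} {z : Esp d × Esp d}
    (h : ∀ᶠ w in 𝓝 z, f (w.1, s • w.2) = f w) (u : Esp d × Esp d) :
    fderiv ℝ f z u = fderiv ℝ f (z.1, s • z.2) (u.1, s • u.2) := by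
  have h1 : f ∘ fiberDilation d s hs =ᶠ[𝓝 z] f := h
  rw [← h1.fderiv_eq, (fiberDilation d s hs).comp_right_fderiv]
  rfl

-- Each product contains exactly one `ξ`-derivative, which contributes the single factor `s`: the
-- bracket is homogeneous of degree `-1`.
open Filter Topology in
theorem poissonBracket_eq_of_fiberDilation_invariant {d : ℕ} {s : ℝ} (hs : s ≠ 0)
    {f g : Esp d × Esp d → ℝ} {z : Esp d × Esp d}
    (hf : ∀ᶠ w in 𝓝 z, f (w.1, s • w.2) = f w) (hg : ∀ᶠ w in 𝓝 z, g (w.1, s • w.2) = g w) :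
    poissonBracket f g z = s * poissonBracket f g (z.1, s • z.2) := by
  unfold poissonBracket
  rw [Finset.mul_sum]
  refine Finset.sum_congr rfl fun j _ => ?_
  have e : ∀ v : Esp d, ((0 : Esp d), s • v) = s • ((0 : Esp d), v) := fun v => by simp
  simp only [fderiv_eq_of_fiberDilation_invariant hs hf,
    fderiv_eq_of_fiberDilation_invariant hs hg, smul_zero, e, map_smul, smul_eq_mul]
  ring

open Filter Topology in
theorem mixedPartial_eq_of_fiberDilation_invariant {d k l : ℕ} {s : ℝ} (hs : s ≠ 0)
    {f : Esp d × Esp d → ℝ} {z : Esp d × Esp d}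
    (h : ∀ᶠ w in 𝓝 z, f (w.1, s • w.2) = f w) (i : Fin k → Fin d) (j : Fin l → Fin d) :
    mixedPartial f i j z = s ^ l * mixedPartial f i j (z.1, s • z.2) := by
  have h1 : f ∘ fiberDilation d s hs =ᶠ[𝓝 z] f := h
  have h2 : iteratedFDeriv ℝ (k + l) f z =
      (iteratedFDeriv ℝ (k + l) f (z.1, s • z.2)).compContinuousLinearMap
        fun _ => (fiberDilation d s hs : (Esp d × Esp d) →L[ℝ] (Esp d × Esp d)) := by
    rw [← (h1.iteratedFDeriv ℝ (k + l)).eq_of_nhds]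
    simp only [← iteratedFDerivWithin_univ]
    exact (fiberDilation d s hs).iteratedFDerivWithin_comp_right f uniqueDiffOn_univ
      (Set.mem_univ _) (k + l)
  unfold mixedPartial
  rw [h2, ContinuousMultilinearMap.compContinuousLinearMap_apply]
  have e : (fun m => (fiberDilation d s hs : (Esp d × Esp d) →L[ℝ] (Esp d × Esp d))
      (Fin.append (fun m => ((EuclideanSpace.single (i m) 1, 0) : Esp d × Esp d))
        (fun m => ((0, EuclideanSpace.single (j m) 1) : Esp d × Esp d)) m)) =
      fun m => (Fin.append (fun _ => (1 : ℝ)) (fun _ => s) m : ℝ) •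
      (Fin.append (fun m => ((EuclideanSpace.single (i m) 1, 0) : Esp d × Esp d))
        (fun m => ((0, EuclideanSpace.single (j m) 1) : Esp d × Esp d)) m) := by
    funext m
    refine Fin.addCases (fun m => ?_) (fun m => ?_) m
    · simp [fiberDilation_apply]
    · simp [fiberDilation_apply]
  rw [e, ContinuousMultilinearMap.map_smul_univ, Fin.prod_univ_add]
  simp

/-- The vector field `(∂_ξ f, -∂_x f)`. -/
def hamiltonField {d : ℕ} (f : Esp d × Esp d → ℝ) (z : Esp d × Esp d) : Esp d × Esp d :=
  (WithLp.toLp 2 fun j => fderiv ℝ f z (0, EuclideanSpace.single j 1),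
    WithLp.toLp 2 fun j => -fderiv ℝ f z (EuclideanSpace.single j 1, 0))

/-- This turns the bracket into a directional derivative, the form that the Glaeser inequality
controls. -/
theorem poissonBracket_eq_fderiv_hamiltonField {d : ℕ} (f g : Esp d × Esp d → ℝ)
    (z : Esp d × Esp d) : poissonBracket f g z = fderiv ℝ g z (hamiltonField f z) := by
  have e : hamiltonField f z =
      ∑ j, ((hamiltonField f z).1 j • ((EuclideanSpace.single j 1, 0) : Esp d × Esp d) +
        (hamiltonField f z).2 j • ((0, EuclideanSpace.single j 1) : Esp d × Esp d)) := by
    apply Prod.ext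
    · simpa [Prod.fst_sum] using euclidean_eq_sum_single (hamiltonField f z).1
    · simpa [Prod.snd_sum] using euclidean_eq_sum_single (hamiltonField f z).2
  rw [e, map_sum, poissonBracket]
  refine Finset.sum_congr rfl fun j _ => ?_
  simp only [map_add, map_smul, smul_eq_mul, hamiltonField]
  ring

theorem hamiltonField_eq_of_fderiv_eq_symplForm {d : ℕ} {f : Esp d × Esp d → ℝ}
    {w z : Esp d × Esp d} (h : ∀ u, fderiv ℝ f w u = symplForm u z) : hamiltonField f w = z := by
  apply Prod.ext <;> ext j <;> simp [hamiltonField, h, symplForm, EuclideanSpace.inner_single_left]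

theorem continuousAt_hamiltonField {d : ℕ} {f : Esp d × Esp d → ℝ} {w : Esp d × Esp d}
    (h : ContinuousAt (fderiv ℝ f) w) : ContinuousAt (hamiltonField f) w := by
  refine ContinuousAt.prodMk ?_ ?_
  · refine (PiLp.continuous_toLp 2 _).continuousAt.comp (continuousAt_pi.2 fun j => ?_)
    exact h.clm_apply continuousAt_const
  · refine (PiLp.continuous_toLp 2 _).continuousAt.comp (continuousAt_pi.2 fun j => ?_)
    exact (h.clm_apply continuousAt_const).neg

/-- The projection `(x, ξ) ↦ (x, |η| ξ / |ξ|)`. -/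
def sphereProj {d : ℕ} (η : Esp d) (z : Esp d × Esp d) : Esp d × Esp d :=
  (z.1, (‖η‖ / ‖z.2‖) • z.2)

theorem contDiffAt_sphereProj {d : ℕ} (η : Esp d) {z : Esp d × Esp d} (hz : z.2 ≠ 0) :
    ContDiffAt ℝ ∞ (sphereProj η) z := by
  have h1 : ContDiffAt ℝ ∞ (fun z : Esp d × Esp d => ‖z.2‖) z := contDiffAt_snd.norm ℝ hz
  exact contDiffAt_fst.prodMk
    ((contDiffAt_const.div h1 (norm_ne_zero_iff.2 hz)).smul contDiffAt_snd)

theorem sphereProj_smul {d : ℕ} (η : Esp d) (x ξ : Esp d) {s : ℝ} (hs : 0 < s) :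
    sphereProj η (x, s • ξ) = sphereProj η (x, ξ) := by
  simp only [sphereProj, norm_smul, Real.norm_of_nonneg hs.le, smul_smul]
  congr 2
  field_simp

theorem sphereProj_of_norm_eq {d : ℕ} {η : Esp d} (hη : η ≠ 0) {z : Esp d × Esp d}
    (hz : ‖z.2‖ = ‖η‖) : sphereProj η z = z := by
  simp [sphereProj, hz, hη]

theorem norm_sphereProj_snd {d : ℕ} (η : Esp d) {z : Esp d × Esp d} (hz : z.2 ≠ 0) :
    ‖(sphereProj η z).2‖ = ‖η‖ := by
  simp [sphereProj, norm_smul, hz]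

/-- The derivative of `sphereProj` at `(x, η)` is the identity up to multiples of `(0, η)`. -/
theorem exists_fderiv_sphereProj {d : ℕ} {η : Esp d} (hη : η ≠ 0) (x : Esp d) :
    ∃ ℓ : Esp d × Esp d → ℝ, ∀ u,
      fderiv ℝ (sphereProj η) (x, η) u = u + ℓ u • ((0, η) : Esp d × Esp d) := by
  have h1 : DifferentiableAt ℝ (fun z : Esp d × Esp d => ‖η‖ / ‖z.2‖) (x, η) := by
    have h1 : ContDiffAt ℝ ∞ (fun z : Esp d × Esp d => ‖z.2‖) (x, η) :=
      contDiffAt_snd.norm ℝ hη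
    exact (contDiffAt_const.div h1 (norm_ne_zero_iff.2 hη)).differentiableAt (by simp)
  have h2 : HasFDerivAt (sphereProj η) _ (x, η) :=
    (hasFDerivAt_fst (𝕜 := ℝ)).prodMk (h1.hasFDerivAt.smul (hasFDerivAt_snd (𝕜 := ℝ)))
  refine ⟨fun u => fderiv ℝ (fun z : Esp d × Esp d => ‖η‖ / ‖z.2‖) (x, η) u, fun u => ?_⟩
  rw [h2.fderiv]
  apply Prod.ext
  · simp
  · simp [hη]

/-! ### The two inequalities near the base point -/

open Set Filter Topology in
/-- The two inequalities near a critical zero of `a`, for `ψ` the zero of the derivative of `a`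
along `(1, y)` and `Z` a continuous family of directions in which `a'' < M`. -/
theorem exists_local_estimate {E : Type*} [NormedAddCommGroup E] [NormedSpace ℝ E]
    {a : ℝ × E → ℝ} {W : Set (ℝ × E)} (hW : IsOpen W) (ha : ContDiffOn ℝ ∞ a W)
    (hpos : ∀ q ∈ W, 0 ≤ q.1 → 0 ≤ a q) {w₀ : E} (hw₀ : (0, w₀) ∈ W)
    (hda : fderiv ℝ a (0, w₀) = 0) {y : E}
    (hy : 0 < fderiv ℝ (fderiv ℝ a) (0, w₀) (1, 0) (1, y)) {ψ : E → ℝ}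
    (hψ : ContinuousAt ψ w₀) (hψ0 : ψ w₀ = 0)
    (hψz : ∀ᶠ w in 𝓝 w₀, fderiv ℝ a (ψ w, w) (1, y) = 0) {Z : E → E} (hZ : ContinuousAt Z w₀)
    {M : ℝ} (hM0 : 0 < M) (hM : fderiv ℝ (fderiv ℝ a) (0, w₀) (0, Z w₀) (0, Z w₀) < M) :
    ∃ c δ : ℝ, 0 < c ∧ 0 < δ ∧ ∀ w ∈ Metric.ball w₀ δ, ∀ t, 0 ≤ t → t < δ →
      (t, w) ∈ W ∧ fderiv ℝ a (t, w) (0, Z w) ^ 2 ≤ 2 * M * a (t, w) ∧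
      c * min (t ^ 2) ((t - ψ w) ^ 2) ≤ a (t, w) := by
  have hsm : ContDiffAt ℝ ∞ a (0, w₀) := ha.contDiffAt (hW.mem_nhds hw₀)
  have hc1 : ContinuousAt (fderiv ℝ a) (0, w₀) :=
    (hsm.fderiv_right (m := 0) (by simp)).continuousAt
  have hc2 : ContinuousAt (fderiv ℝ (fderiv ℝ a)) (0, w₀) :=
    ((hsm.fderiv_right (m := 1) (by norm_num; norm_cast)).fderiv_right (m := 0) (by norm_num)).continuousAt
  obtain ⟨m, hm0, hm⟩ := exists_between hy
  -- The maximum with `0` makes `M₁` positive, as division by it requires.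
  obtain ⟨M₁, hM₁⟩ := exists_gt (max 0 (fderiv ℝ (fderiv ℝ a) (0, w₀) (1, y) (1, y)))
  obtain ⟨hM₁0, hM₁1⟩ := max_lt_iff.1 hM₁
  have ev1 : ∀ᶠ q in 𝓝 ((0 : ℝ), w₀), m < fderiv ℝ (fderiv ℝ a) q (1, 0) (1, y) :=
    ((hc2.clm_apply continuousAt_const).clm_apply continuousAt_const).eventually
      (lt_mem_nhds hm)
  have ev2 : ∀ᶠ q in 𝓝 ((0 : ℝ), w₀), fderiv ℝ (fderiv ℝ a) q (1, y) (1, y) < M₁ :=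
    ((hc2.clm_apply continuousAt_const).clm_apply continuousAt_const).eventually
      (gt_mem_nhds hM₁1)
  -- Base point and direction vary independently here: the Glaeser inequality needs the bound at all
  -- points of `D` for one fixed direction `Z w`.
  have ev3 : ∀ᶠ q : (ℝ × E) × E in 𝓝 (((0 : ℝ), w₀), Z w₀),
      fderiv ℝ (fderiv ℝ a) q.1 (0, q.2) (0, q.2) < M := by
    have h1 : ContinuousAt (fun q : (ℝ × E) × E => fderiv ℝ (fderiv ℝ a) q.1)
        (((0 : ℝ), w₀), Z w₀) := ContinuousAt.comp (f := Prod.fst) hc2 continuousAt_fst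
    have h2 : ContinuousAt (fun q : (ℝ × E) × E => ((0 : ℝ), q.2)) (((0 : ℝ), w₀), Z w₀) := by
      fun_prop
    exact ((h1.clm_apply h2).clm_apply h2).eventually (gt_mem_nhds hM)
  rw [nhds_prod_eq, eventually_prod_iff] at ev3
  obtain ⟨P, hP, Q, hQ, hPQ⟩ := ev3
  obtain ⟨r, hr, hD⟩ := Metric.eventually_nhds_iff_ball.1
    (((ev1.and ev2).and hP).and (hW.eventually_mem hw₀))
  set D := Metric.ball ((0 : ℝ), w₀) r with hDdef
  have hDn : D ∈ 𝓝 ((0 : ℝ), w₀) := Metric.ball_mem_nhds _ hr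
  have hDsm : ∀ q ∈ D, ContDiffAt ℝ 2 a q := fun q hq =>
    (ha.contDiffAt (hW.mem_nhds (hD q hq).2)).of_le (by norm_cast)
  have hDconv : Convex ℝ D := convex_ball _ _
  have hZ' : ContinuousAt (fun q : ℝ × E => Z q.2) (0, w₀) :=
    ContinuousAt.comp (f := Prod.snd) (g := Z) hZ continuousAt_snd
  have hψ' : ContinuousAt (fun q : ℝ × E => ψ q.2) (0, w₀) :=
    ContinuousAt.comp (f := Prod.snd) (g := ψ) hψ continuousAt_snd
  have hZ0 : ContinuousAt (fun q : ℝ × E => ((0 : ℝ), Z q.2)) (0, w₀) :=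
    continuousAt_const.prodMk hZ'
  have ev4 : ∀ᶠ q : ℝ × E in 𝓝 (0, w₀), Q (Z q.2) := hZ'.eventually hQ
  -- The Glaeser steps stay in `D`, since their lengths tend to `0` with `da`.
  have ev5 : ∀ᶠ q : ℝ × E in 𝓝 (0, w₀),
      q + (-(fderiv ℝ a q (0, Z q.2) / M)) • ((0 : ℝ), Z q.2) ∈ D := by
    have h1 : ContinuousAt (fun q : ℝ × E =>
        q + (-(fderiv ℝ a q (0, Z q.2) / M)) • ((0 : ℝ), Z q.2)) (0, w₀) :=
      continuousAt_id.add ((((hc1.clm_apply hZ0).div_const M).neg).smul hZ0)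
    exact h1.eventually_mem (by simpa [hda] using hDn)
  have ev6 : ∀ᶠ q : ℝ × E in 𝓝 (0, w₀),
      q + (-(fderiv ℝ a q (1, y) / M₁)) • ((1 : ℝ), y) ∈ D := by
    have h1 : ContinuousAt (fun q : ℝ × E =>
        q + (-(fderiv ℝ a q (1, y) / M₁)) • ((1 : ℝ), y)) (0, w₀) :=
      continuousAt_id.add ((((hc1.clm_apply continuousAt_const).div_const M₁).neg).smul
        continuousAt_const)
    exact h1.eventually_mem (by simpa [hda] using hDn)
  have ev7 : ∀ᶠ q : ℝ × E in 𝓝 (0, w₀), q + (-q.1) • ((1 : ℝ), y) ∈ D := by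
    have h1 : ContinuousAt (fun q : ℝ × E => q + (-q.1) • ((1 : ℝ), y)) (0, w₀) := by fun_prop
    exact h1.eventually_mem (by simpa using hDn)
  have ev8 : ∀ᶠ q : ℝ × E in 𝓝 (0, w₀), (ψ q.2, q.2) ∈ D := by
    exact (hψ'.prodMk continuousAt_snd).eventually_mem (by simpa [hψ0] using hDn)
  have ev9 : ∀ᶠ q : ℝ × E in 𝓝 (0, w₀), fderiv ℝ a (ψ q.2, q.2) (1, y) = 0 :=
    (continuous_snd.tendsto ((0 : ℝ), w₀)).eventually hψz
  obtain ⟨δ, hδ, hB⟩ := Metric.eventually_nhds_iff_ball.1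
    ((((ev4.and ev5).and (ev6.and ev7)).and (ev8.and ev9)).and
      (Metric.ball_mem_nhds ((0 : ℝ), w₀) hr))
  refine ⟨min (M₁ / 2) (m ^ 2 / (2 * M₁)), δ, lt_min (by positivity) (by positivity), hδ, ?_⟩
  intro w hw t ht0 htδ
  have hq : (t, w) ∈ Metric.ball ((0 : ℝ), w₀) δ := by
    rw [Metric.mem_ball, Prod.dist_eq, max_lt_iff]
    exact ⟨by simpa [abs_of_nonneg ht0] using htδ, hw⟩
  obtain ⟨⟨⟨⟨b4, b5⟩, b6, b7⟩, b8, b9⟩, bD⟩ := hB _ hq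
  have bD' : (t, w) ∈ D := bD
  have hqW := (hD _ bD').2
  refine ⟨hqW, ?_, ?_⟩
  · refine fderiv_sq_le_of_nonneg hDconv hDsm hM0 (fun x hx => ?_) bD' b5
      (hpos _ (hD _ b5).2 (by simpa using ht0))
    exact (hPQ (hD x hx).1.2 b4).le
  · have ha0 := hpos _ hqW ht0
    have hYM : ∀ x ∈ D, fderiv ℝ (fderiv ℝ a) x (1, y) (1, y) ≤ M₁ := fun x hx =>
      (hD x hx).1.1.2.le
    by_cases hcase : fderiv ℝ a (t, w) (1, y) / M₁ ≤ t
    · have h1 := fderiv_sq_le_of_nonneg hDconv hDsm hM₁0 hYM bD' b6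
        (hpos _ (hD _ b6).2 (by simpa using hcase))
      have hd2 : ∀ q ∈ D, HasFDerivAt (fun q => fderiv ℝ a q (1, y))
          ((fderiv ℝ (fderiv ℝ a) q).flip (1, y)) q := fun q hq => by
        have h3 : DifferentiableAt ℝ (fderiv ℝ a) q :=
          ((hDsm q hq).fderiv_right (m := 1) (by norm_num)).differentiableAt (by norm_num)
        simpa using h3.hasFDerivAt.clm_apply (hasFDerivAt_const ((1 : ℝ), y) q)
      have h2 := mul_abs_sub_le_of_le_fderiv (Φ := fun q => fderiv ℝ a q (1, y)) hDconv
        (fun q hq => (hd2 q hq).differentiableAt) (m := m)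
        (fun q hq => by rw [(hd2 q hq).fderiv]; exact (hD q hq).1.1.1.le) bD' b8
      simp only [b9, sub_zero] at h2
      have h3 : (m * |t - ψ w|) ^ 2 ≤ fderiv ℝ a (t, w) (1, y) ^ 2 := by
        rw [← sq_abs (fderiv ℝ a (t, w) (1, y))]
        exact pow_le_pow_left₀ (by positivity) h2 2
      rw [mul_pow, sq_abs] at h3
      calc min (M₁ / 2) (m ^ 2 / (2 * M₁)) * min (t ^ 2) ((t - ψ w) ^ 2)
          ≤ m ^ 2 / (2 * M₁) * (t - ψ w) ^ 2 :=
            mul_le_mul (min_le_right _ _) (min_le_right _ _) (by positivity) (by positivity)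
        _ = m ^ 2 * (t - ψ w) ^ 2 / (2 * M₁) := by ring
        _ ≤ a (t, w) := by
            rw [div_le_iff₀ (by positivity)]
            linarith
    -- The step is cut off at time `0`: `0 ≤ a - t ∂_{(1,y)} a + M₁ t² / 2`, while `∂_{(1,y)} a > M₁
    -- t`.
    · rw [not_le, lt_div_iff₀ hM₁0] at hcase
      have h1 := apply_add_le_of_secondDeriv_le hDconv hDsm (u := (-t) • ((1 : ℝ), y))
        (M := t ^ 2 * M₁) (fun x hx => by
          simp only [map_smul, smul_apply, smul_eq_mul]
          rw [← mul_assoc, neg_mul_neg, ← sq]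
          exact mul_le_mul_of_nonneg_left (hYM x hx) (sq_nonneg t)) bD' b7
      have h2 := hpos _ (hD _ b7).2 (by simp)
      rw [map_smul, smul_eq_mul] at h1
      simp only at h2
      have h3 : t * (t * M₁) ≤ t * fderiv ℝ a (t, w) (1, y) :=
        mul_le_mul_of_nonneg_left hcase.le ht0
      calc min (M₁ / 2) (m ^ 2 / (2 * M₁)) * min (t ^ 2) ((t - ψ w) ^ 2)
          ≤ M₁ / 2 * t ^ 2 :=
            mul_le_mul (min_le_left _ _) (min_le_left _ _) (by positivity) (by positivity)
        _ ≤ a (t, w) := by nlinarith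

/-! ### Directions and phase at an effectively hyperbolic point -/

open Set Filter Topology in
/-- Homogeneity puts the radial direction into the radical of the Hessian at a critical point. -/
theorem secondDeriv_radial_eq_zero {d : ℕ} {a : ℝ × Esp d × Esp d → ℝ}
    {W : Set (ℝ × Esp d × Esp d)} (hW : IsOpen W) (ha : ContDiffOn ℝ ∞ a W)
    (hhom : ∀ t x ξ, (t, x, ξ) ∈ W → ∀ s : ℝ, 0 < s → a (t, x, s • ξ) = a (t, x, ξ))
    {q : ℝ × Esp d × Esp d} (hq : q ∈ W) (hda : fderiv ℝ a q = 0) (u : ℝ × Esp d × Esp d) :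
    fderiv ℝ (fderiv ℝ a) q u (0, 0, q.2.2) = 0 := by
  have hsm : ∀ p ∈ W, ContDiffAt ℝ ∞ a p := fun p hp => ha.contDiffAt (hW.mem_nhds hp)
  -- Euler's identity; differentiating it at `q` leaves only the Hessian term, because `da` vanishes
  -- there.
  have hE : ∀ p ∈ W, fderiv ℝ a p (0, 0, p.2.2) = 0 := by
    intro p hp
    have h1 : HasDerivAt (fun s : ℝ => p + (s - 1) • ((0 : ℝ), (0 : Esp d), p.2.2))
        (0, 0, p.2.2) 1 := by
      simpa using (((hasDerivAt_id (1 : ℝ)).sub_const 1).smul_const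
        ((0 : ℝ), (0 : Esp d), p.2.2)).const_add p
    have h0 : p + ((1 : ℝ) - 1) • ((0 : ℝ), (0 : Esp d), p.2.2) = p := by simp
    have h2 : HasDerivAt (fun s : ℝ => a (p + (s - 1) • ((0 : ℝ), (0 : Esp d), p.2.2)))
        (fderiv ℝ a p (0, 0, p.2.2)) 1 := by
      refine HasFDerivAt.comp_hasDerivAt (l := a) (1 : ℝ) ?_ h1
      rw [h0]
      exact ((hsm p hp).differentiableAt (by simp)).hasFDerivAt
    have h3 : (fun s : ℝ => a (p + (s - 1) • ((0 : ℝ), (0 : Esp d), p.2.2))) =ᶠ[𝓝 1]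
        fun _ => a p := by
      filter_upwards [lt_mem_nhds (zero_lt_one (α := ℝ))] with s hs
      have e : p + (s - 1) • ((0 : ℝ), (0 : Esp d), p.2.2) = (p.1, p.2.1, s • p.2.2) := by
        refine Prod.ext (by simp) (Prod.ext (by simp) ?_)
        simp [sub_smul]
      rw [e, hhom _ _ _ hp s hs]
    exact (h2.congr_of_eventuallyEq h3.symm).unique (hasDerivAt_const 1 (a p))
  have hd : DifferentiableAt ℝ (fderiv ℝ a) q :=
    ((hsm q hq).fderiv_right (m := 1) (by norm_num; norm_cast)).differentiableAt (by norm_num)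
  have hl : HasFDerivAt (fun p : ℝ × Esp d × Esp d => ((0 : ℝ), (0 : Esp d), p.2.2)) _ q :=
    (((0 : (ℝ × Esp d × Esp d) →L[ℝ] ℝ).prod ((0 : (ℝ × Esp d × Esp d) →L[ℝ] Esp d).prod
      ((ContinuousLinearMap.snd ℝ (Esp d) (Esp d)).comp
        (ContinuousLinearMap.snd ℝ ℝ (Esp d × Esp d))))).hasFDerivAt (x := q))
  have h1 := hd.hasFDerivAt.clm_apply hl
  have h2 : (fun p : ℝ × Esp d × Esp d => fderiv ℝ a p (0, 0, p.2.2)) =ᶠ[𝓝 q] fun _ => 0 := by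
    filter_upwards [hW.mem_nhds hq] with p hp using hE p hp
  have h3 := (h1.congr_of_eventuallyEq h2.symm).unique (hasFDerivAt_const 0 q)
  have h4 := congrArg (fun L => L u) h3
  simpa [hda] using h4

theorem fderiv_slice {E : Type*} [NormedAddCommGroup E] [NormedSpace ℝ E] {a : ℝ × E → ℝ}
    {t : ℝ} {w : E} (ha : DifferentiableAt ℝ a (t, w)) (u : E) :
    fderiv ℝ (fun z => a (t, z)) w u = fderiv ℝ a (t, w) (0, u) := by
  have h : HasFDerivAt (fun z => a (t, z)) _ w :=
    ha.hasFDerivAt.comp w ((hasFDerivAt_const t w).prodMk (hasFDerivAt_id w))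
  rw [h.fderiv]
  simp

open Filter Topology in
/-- The derivative of an implicitly defined function. -/
theorem fderiv_implicit_solution {E : Type*} [NormedAddCommGroup E] [NormedSpace ℝ E]
    {Φ : ℝ × E → ℝ} {ψ : E → ℝ} {w : E} (hψ : DifferentiableAt ℝ ψ w)
    (hΦ : DifferentiableAt ℝ Φ (ψ w, w)) (h : ∀ᶠ v in 𝓝 w, Φ (ψ v, v) = 0) (u : E) :
    fderiv ℝ ψ w u * fderiv ℝ Φ (ψ w, w) (1, 0) = -fderiv ℝ Φ (ψ w, w) (0, u) := by
  have h1 : HasFDerivAt (fun v => Φ (ψ v, v)) _ w :=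
    HasFDerivAt.comp (f := fun v => (ψ v, v)) w hΦ.hasFDerivAt
      (hψ.hasFDerivAt.prodMk (hasFDerivAt_id w))
  have h2 : (fun v => Φ (ψ v, v)) =ᶠ[𝓝 w] fun _ => 0 := h
  have h3 := (h1.congr_of_eventuallyEq h2.symm).unique (hasFDerivAt_const 0 w)
  have h4 : fderiv ℝ Φ (ψ w, w) (fderiv ℝ ψ w u, u) = 0 := congrArg (fun L => L u) h3
  have e : (fderiv ℝ ψ w u, u) = fderiv ℝ ψ w u • ((1 : ℝ), (0 : E)) + (0, u) := by simp
  rw [e, map_add, map_smul, smul_eq_mul] at h4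
  linarith

open Filter Topology in
/-- The directions attached to an effectively hyperbolic point. -/
theorem exists_directions {d : ℕ} {η : Esp d} {a : ℝ × Esp d × Esp d → ℝ}
    {W : Set (ℝ × Esp d × Esp d)} (hη : η ≠ 0) (hW : IsOpen W) (hmem : (0, 0, η) ∈ W)
    (ha : ContDiffOn ℝ ∞ a W)
    (hpos : ∀ t x ξ, (t, x, ξ) ∈ W → 0 ≤ t → 0 ≤ a (t, x, ξ))
    (h_eff : IsEffectivelyHyperbolic (secondOrderSymbol a) ((0, 0), (0, η))) :
    ∃ (y z : Esp d × Esp d) (m : ℝ), 0 < m ∧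
      (∀ u, fderiv ℝ (fderiv ℝ a) (0, 0, η) u (1, y) = m * (u.1 - symplForm u.2 z)) ∧
      ‖η‖ ^ 2 * fderiv ℝ (fderiv ℝ a) (0, 0, η) (0, z) (0, z) < 2 ∧
      0 ≤ fderiv ℝ (fderiv ℝ a) (0, 0, η) (0, z) (0, z) := by
  have hsm : ContDiffAt ℝ 2 a (0, 0, η) :=
    (ha.contDiffAt (hW.mem_nhds hmem)).of_le (by norm_cast)
  have h0 : a (0, 0, η) = 0 := h_eff.1.apply_eq_zero hη
  have h1 : fderiv ℝ a (0, 0, η) = 0 :=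
    h_eff.1.fderiv_eq_zero hη (hsm.differentiableAt (by norm_num))
  have hN : 0 < ‖η‖ ^ 2 := by positivity
  have hsymm : ∀ u v, fderiv ℝ (fderiv ℝ a) (0, 0, η) u v =
      fderiv ℝ (fderiv ℝ a) (0, 0, η) v u := fun u v =>
    (hsm.isSymmSndFDerivAt (by simp)).eq u v
  have hpsd₁ : ∀ u : ℝ × Esp d × Esp d, 0 ≤ u.1 →
      0 ≤ fderiv ℝ (fderiv ℝ a) (0, 0, η) u u := by
    intro u hu
    refine secondDeriv_nonneg_of_eventually_nonneg hsm h0 h1 ?_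
    have hc : Continuous fun s : ℝ => ((0 : ℝ), (0 : Esp d), η) + s • u := by fun_prop
    have hev : ∀ᶠ s : ℝ in 𝓝[>] 0, ((0 : ℝ), (0 : Esp d), η) + s • u ∈ W :=
      (hc.continuousAt.eventually_mem (by simpa using hW.mem_nhds hmem)).filter_mono
        nhdsWithin_le_nhds
    filter_upwards [hev, self_mem_nhdsWithin] with s hs hs0
    refine hpos _ _ _ hs ?_
    have : (0 : ℝ) < s := hs0
    simpa using mul_nonneg this.le hu
  -- The quadratic form is even, so the half-space `t ≥ 0` suffices.
  have hpsd : ∀ u, 0 ≤ fderiv ℝ (fderiv ℝ a) (0, 0, η) u u := by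
    intro u
    rcases le_total 0 u.1 with hu | hu
    · exact hpsd₁ u hu
    · have := hpsd₁ (-u) (by simpa using hu)
      simpa using this
  obtain ⟨μ, hμ, hp, hm⟩ := h_eff.2
  obtain ⟨y, z, m, hm0, hYu, hz⟩ := exists_spacelike_direction
    (B := ‖η‖ ^ 2 • fderiv ℝ (fderiv ℝ a) (0, 0, η))
    (fun u v => by simp [hsymm u v])
    (fun u => by simpa using mul_nonneg hN.le (hpsd u)) hμ (fun s hs => by
      have hs' : Module.End.HasEigenvalue
          (Matrix.toLin' (hamiltonMap (secondOrderSymbol a) ((0, 0), (0, η)))) s := by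
        rcases hs with rfl | rfl
        · exact hp
        · exact hm
      obtain ⟨V, hV0, hV⟩ := exists_secondDeriv_eq_of_hasEigenvalue hs'
      refine ⟨V, hV0, fun U => ?_⟩
      rw [← hV U, secondDeriv_secondOrderSymbol hsm h0 h1]
      rfl)
  refine ⟨y, z, m / ‖η‖ ^ 2, by positivity, fun u => ?_, hz, hpsd _⟩
  have := hYu u
  simp only [smul_apply, smul_eq_mul] at this
  field_simp
  linarith

open Set Filter Topology in
/-- The phase function `ψ` near `(0, η)`. -/
theorem exists_phase {d : ℕ} {η : Esp d} {a : ℝ × Esp d × Esp d → ℝ}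
    {W : Set (ℝ × Esp d × Esp d)} (hW : IsOpen W) (hmem : (0, 0, η) ∈ W)
    (ha : ContDiffOn ℝ ∞ a W) (hda : fderiv ℝ a (0, 0, η) = 0) {y z : Esp d × Esp d} {m : ℝ}
    (hm : 0 < m)
    (hY : ∀ u, fderiv ℝ (fderiv ℝ a) (0, 0, η) u (1, y) = m * (u.1 - symplForm u.2 z)) :
    ∃ (ψ : Esp d × Esp d → ℝ) (U : Set (Esp d × Esp d)), IsOpen U ∧ (0, η) ∈ U ∧
      ψ (0, η) = 0 ∧ ContDiffOn ℝ ∞ ψ U ∧ (∀ w ∈ U, fderiv ℝ a (ψ w, w) (1, y) = 0) ∧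
      ∀ u, fderiv ℝ ψ (0, η) u = symplForm u z := by
  have hsm : ∀ q ∈ W, ContDiffAt ℝ ∞ a q := fun q hq => ha.contDiffAt (hW.mem_nhds hq)
  have hΦ : ContDiffOn ℝ ∞ (fun q => fderiv ℝ a q (1, y)) W := fun q hq =>
    (((hsm q hq).fderiv_right (m := ∞) (by simp)).clm_apply contDiffAt_const).contDiffWithinAt
  have hd : ∀ q ∈ W, HasFDerivAt (fun q => fderiv ℝ a q (1, y))
      ((fderiv ℝ (fderiv ℝ a) q).flip (1, y)) q := fun q hq => by
    have h3 : DifferentiableAt ℝ (fderiv ℝ a) q :=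
      ((hsm q hq).fderiv_right (m := 1) (by norm_num; norm_cast)).differentiableAt (by norm_num)
    simpa using h3.hasFDerivAt.clm_apply (hasFDerivAt_const ((1 : ℝ), y) q)
  have hc2 : ContinuousAt (fderiv ℝ (fderiv ℝ a)) (0, 0, η) :=
    (((hsm _ hmem).fderiv_right (m := 1) (by norm_num; norm_cast)).fderiv_right (m := 0)
      (by norm_num)).continuousAt
  have hbase : fderiv ℝ (fderiv ℝ a) (0, 0, η) (1, 0) (1, y) = m := by
    rw [hY]; simp [symplForm]
  have ev : ∀ᶠ q in 𝓝 ((0 : ℝ), (0 : Esp d), η),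
      0 < fderiv ℝ (fderiv ℝ a) q (1, 0) (1, y) :=
    ((hc2.clm_apply continuousAt_const).clm_apply continuousAt_const).eventually
      (lt_mem_nhds (hm.trans_eq hbase.symm))
  obtain ⟨r, hr, hD⟩ := Metric.eventually_nhds_iff_ball.1 (ev.and (hW.eventually_mem hmem))
  obtain ⟨ψ, U, hU, hmU, hψ0, hψs, hψz⟩ := exists_implicit_solution (t₀ := 0)
    (w₀ := ((0 : Esp d), η)) Metric.isOpen_ball (hΦ.mono fun q hq => (hD q hq).2)
    (Metric.mem_ball_self hr) (by simp [hda])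
    (fun q hq => by rw [(hd q (hD q hq).2).fderiv]; exact (hD q hq).1.ne')
  refine ⟨ψ, U, hU, hmU, hψ0, hψs, fun w hw => (hψz w hw).2, fun u => ?_⟩
  have hdψ : DifferentiableAt ℝ ψ (0, η) :=
    (hψs.contDiffAt (hU.mem_nhds hmU)).differentiableAt (by simp)
  have h1 := fderiv_implicit_solution (Φ := fun q => fderiv ℝ a q (1, y)) hdψ
    (by rw [hψ0]; exact (hd _ hmem).differentiableAt)
    (by filter_upwards [hU.mem_nhds hmU] with w hw using (hψz w hw).2) u
  rw [hψ0, (hd _ hmem).fderiv] at h1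
  simp only [ContinuousLinearMap.flip_apply, hY] at h1
  simp only [symplForm, Prod.fst_zero, Prod.snd_zero, inner_zero_left] at h1 ⊢
  have h2 : m * (fderiv ℝ ψ (0, η) u - (inner ℝ u.2 z.1 - inner ℝ u.1 z.2)) = 0 := by linarith
  have h3 := (mul_eq_zero.1 h2).resolve_left hm.ne'
  linarith

/-! ### Symbol estimates and passage to a cone -/

open Set Filter Topology in
/-- A function that is homogeneous of degree `0` and smooth on a conic neighbourhood satisfies the
symbol estimates on a smaller one. -/
theorem hasSymbolBounds_of_homogeneous {d : ℕ} {η : Esp d} {f : Esp d × Esp d → ℝ}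
    {V₁ : Set (Esp d × Esp d)} (hη : η ≠ 0) (hV₁ : IsOpen V₁) (hf : ContDiffOn ℝ ∞ f V₁)
    (hhom : ∀ z ∈ V₁, ∀ s : ℝ, 0 < s → f (z.1, s • z.2) = f z) {δ : ℝ}
    (hδ : Metric.closedBall (0, η) δ ⊆ V₁) {V : Set (Esp d × Esp d)}
    (hV : ∀ z ∈ V, z.2 ≠ 0 ∧ z ∈ V₁ ∧ sphereProj η z ∈ Metric.closedBall (0, η) δ) :
    HasSymbolBounds f V := by
  intro k l i j
  have hcont : ContinuousOn (mixedPartial f i j) (Metric.closedBall (0, η) δ) := by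
    intro z hz
    have h1 : ContDiffAt ℝ ∞ f z := hf.contDiffAt (hV₁.mem_nhds (hδ hz))
    have h2 : ContinuousAt (iteratedFDeriv ℝ (k + l) f) z :=
      (h1.iteratedFDeriv_right (m := 0) (i := k + l) (by
        rw [zero_add]; exact_mod_cast le_top)).continuousAt
    exact ((ContinuousMultilinearMap.apply ℝ _ ℝ _).continuous.continuousAt.comp
      h2).continuousWithinAt
  obtain ⟨C, hC⟩ := (isCompact_closedBall ((0 : Esp d), η) δ).exists_bound_of_continuousOn hcont
  -- `C` bounds the derivative on the compact ball; rescaling to `|ξ| = |η|` costs `(|η| / |ξ|)^l`,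
  -- and `⟨ξ⟩ ≤ 2|ξ|` for `|ξ| ≥ 1`.
  refine ⟨(2 * ‖η‖) ^ l * C, fun x ξ hz hξ => ?_⟩
  obtain ⟨hz0, hz1, hz2⟩ := hV _ hz
  have hz0' : 0 < ‖ξ‖ := norm_pos_iff.2 hz0
  have hη' : 0 < ‖η‖ := norm_pos_iff.2 hη
  have hs : 0 < ‖η‖ / ‖ξ‖ := by positivity
  rw [mixedPartial_eq_of_fiberDilation_invariant hs.ne'
    (by filter_upwards [hV₁.mem_nhds hz1] with w hw using hhom w hw _ hs) i j, abs_mul,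
    abs_of_nonneg (by positivity)]
  have h1 : |mixedPartial f i j (x, (‖η‖ / ‖ξ‖) • ξ)| ≤ C := hC _ hz2
  have hC0 : 0 ≤ C := (abs_nonneg _).trans h1
  have h2 : Real.sqrt (1 + ‖ξ‖ ^ 2) ≤ 2 * ‖ξ‖ := by
    rw [Real.sqrt_le_left (by positivity)]
    nlinarith
  have h3 : 0 < Real.sqrt (1 + ‖ξ‖ ^ 2) := Real.sqrt_pos.2 (by positivity)
  calc (‖η‖ / ‖ξ‖) ^ l * |mixedPartial f i j (x, (‖η‖ / ‖ξ‖) • ξ)|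
      ≤ (2 * ‖η‖ / Real.sqrt (1 + ‖ξ‖ ^ 2)) ^ l * C := by
        refine mul_le_mul (pow_le_pow_left₀ hs.le ?_ l) h1 (abs_nonneg _) (by positivity)
        rw [div_le_div_iff₀ hz0' h3]
        nlinarith
    _ = (2 * ‖η‖) ^ l * C / Real.sqrt (1 + ‖ξ‖ ^ 2) ^ l := by rw [div_pow]; ring

theorem isOpen_preimage_sphereProj {d : ℕ} (η : Esp d) {U : Set (Esp d × Esp d)}
    (hU : IsOpen U) : IsOpen {w : Esp d × Esp d | w.2 ≠ 0 ∧ sphereProj η w ∈ U} :=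
  ContinuousOn.isOpen_inter_preimage (f := sphereProj η) (s := {w | w.2 ≠ 0})
    (fun _ hw => (contDiffAt_sphereProj η hw).continuousAt.continuousWithinAt)
    (isOpen_ne.preimage continuous_snd) hU

end

open Set Filter Topology in
theorem mainTheorem11 (d : ℕ) (η : Esp d) (a : ℝ × Esp d × Esp d → ℝ)
    (W : Set (ℝ × Esp d × Esp d)) (hW : IsConicNhdT W 0 0 η)
    (ha_smooth : ContDiffOn ℝ ∞ a W)
    (ha_hom : ∀ t x ξ, (t, x, ξ) ∈ W → ∀ s : ℝ, 0 < s → a (t, x, s • ξ) = a (t, x, ξ))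
    (ha_nonneg : ∀ t x ξ, (t, x, ξ) ∈ W → 0 ≤ t → 0 ≤ a (t, x, ξ))
    (h_eff : IsEffectivelyHyperbolic (secondOrderSymbol a) ((0, 0), (0, η))) :
    ∃ (V : Set (Esp d × Esp d)) (ψ : Esp d × Esp d → ℝ) (κ c T : ℝ),
      IsConicNhd V 0 η ∧ 0 < T ∧ 0 < κ ∧ κ < 1 ∧ 0 < c ∧
      (∀ t x ξ, 0 ≤ t → t < T → (x, ξ) ∈ V → (t, x, ξ) ∈ W) ∧
      ContDiffOn ℝ ∞ ψ V ∧
      (∀ x ξ, (x, ξ) ∈ V → ∀ s : ℝ, 0 < s → ψ (x, s • ξ) = ψ (x, ξ)) ∧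
      HasSymbolBounds ψ V ∧
      (∀ t x ξ, 0 ≤ t → t < T → (x, ξ) ∈ V →
        ‖ξ‖ ^ 2 * poissonBracket ψ (fun z => a (t, z)) (x, ξ) ^ 2 ≤ 4 * κ * a (t, x, ξ) ∧
        c * min (t ^ 2) ((t - ψ (x, ξ)) ^ 2) ≤ a (t, x, ξ)) := by
  obtain ⟨hWo, hmem, hcone⟩ := hW
  have hη : η ≠ 0 := (hcone _ _ _ hmem).1
  have hη' : 0 < ‖η‖ := norm_pos_iff.2 hη
  have hda : fderiv ℝ a (0, 0, η) = 0 := h_eff.1.fderiv_eq_zero hη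
    ((ha_smooth.contDiffAt (hWo.mem_nhds hmem)).differentiableAt (by simp))
  obtain ⟨y, z, m, hm, hY, hz2, hz0⟩ :=
    exists_directions hη hWo hmem ha_smooth ha_nonneg h_eff
  obtain ⟨φ, U, hU, hmU, hφ0, hφs, hφz, hφd⟩ := exists_phase hWo hmem ha_smooth hda hm hY
  -- the radial derivative of `φ` vanishes at the base point
  have hrad : symplForm ((0 : Esp d), η) z = 0 := by
    have hsm : ContDiffAt ℝ 2 a (0, 0, η) :=
      (ha_smooth.contDiffAt (hWo.mem_nhds hmem)).of_le (by norm_cast)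
    have h1 := secondDeriv_radial_eq_zero hWo ha_smooth ha_hom hmem hda (1, y)
    rw [(hsm.isSymmSndFDerivAt (by simp)).eq, hY] at h1
    simpa [hm.ne'] using h1
  have hP0 : sphereProj η ((0 : Esp d), η) = (0, η) := sphereProj_of_norm_eq hη rfl
  -- `φ` need not be homogeneous; `ψ` agrees with it on `|ξ| = |η|` and is.
  let ψ : Esp d × Esp d → ℝ := fun w => φ (sphereProj η w)
  let V₁ : Set (Esp d × Esp d) := {w | w.2 ≠ 0 ∧ sphereProj η w ∈ U}
  have hV₁ : IsOpen V₁ := isOpen_preimage_sphereProj η hU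
  have hmV₁ : ((0 : Esp d), η) ∈ V₁ := ⟨hη, by rw [hP0]; exact hmU⟩
  have hψs : ∀ w ∈ V₁, ContDiffAt ℝ ∞ ψ w := fun w hw =>
    (hφs.contDiffAt (hU.mem_nhds hw.2)).comp w (contDiffAt_sphereProj η hw.1)
  have hψhom : ∀ w : Esp d × Esp d, ∀ s : ℝ, 0 < s → ψ (w.1, s • w.2) = ψ w := fun w s hs =>
    congrArg φ (sphereProj_smul η w.1 w.2 hs)
  -- The projection changes `u` only by a multiple of `(0, η)`, on which `dφ` vanishes by `hrad`.
  have hψd : ∀ u, fderiv ℝ ψ (0, η) u = symplForm u z := by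
    intro u
    obtain ⟨ℓ, hℓ⟩ := exists_fderiv_sphereProj hη (0 : Esp d)
    have h1 : HasFDerivAt ψ _ ((0 : Esp d), η) :=
      HasFDerivAt.comp (g := φ) (f := sphereProj η) ((0 : Esp d), η)
        (by rw [hP0]; exact ((hφs.contDiffAt (hU.mem_nhds hmU)).differentiableAt
              (by simp)).hasFDerivAt)
        ((contDiffAt_sphereProj η (z := ((0 : Esp d), η)) hη).differentiableAt
          (by simp)).hasFDerivAt
    rw [h1.fderiv, ContinuousLinearMap.comp_apply, hℓ, map_add, map_smul, hφd, hφd, hrad]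
    simp
  have hHz : hamiltonField ψ (0, η) = z := hamiltonField_eq_of_fderiv_eq_symplForm hψd
  have hHc : ContinuousAt (hamiltonField ψ) (0, η) := continuousAt_hamiltonField
    ((hψs _ hmV₁).fderiv_right (m := 0) (by simp)).continuousAt
  -- The strict gap below `2 / |η|²` makes `κ = |η|² M / 2` less than `1`.
  obtain ⟨M, hM1, hM2⟩ := exists_between
    (show fderiv ℝ (fderiv ℝ a) (0, 0, η) (0, z) (0, z) < 2 / ‖η‖ ^ 2 by
      rw [lt_div_iff₀ (by positivity)]; linarith)
  have hM0 : 0 < M := hz0.trans_lt hM1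
  rw [lt_div_iff₀ (by positivity)] at hM2
  obtain ⟨c, δ, hc, hδ, hloc⟩ := exists_local_estimate (w₀ := ((0 : Esp d), η)) (y := y) (ψ := φ)
    (Z := hamiltonField ψ) (M := M) hWo ha_smooth (fun q hq => ha_nonneg _ _ _ hq) hmem hda
    (by rw [hY]; simpa [symplForm] using hm) (hφs.contDiffAt (hU.mem_nhds hmU)).continuousAt hφ0
    (by filter_upwards [hU.mem_nhds hmU] with w hw using hφz w hw) hHc hM0
    (by rw [hHz]; exact hM1)
  obtain ⟨r, hr, hrV⟩ := Metric.nhds_basis_closedBall.mem_iff.1 (hV₁.mem_nhds hmV₁)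
  -- The radius `r` serves the symbol estimates, `δ` the two inequalities.
  let V : Set (Esp d × Esp d) :=
    {w | w.2 ≠ 0 ∧ sphereProj η w ∈ Metric.ball ((0 : Esp d), η) (min r δ)}
  have hVo : IsOpen V := isOpen_preimage_sphereProj η Metric.isOpen_ball
  have hsub : ∀ w ∈ V, sphereProj η w ∈ V₁ := fun w hw =>
    hrV (Metric.ball_subset_closedBall (Metric.ball_subset_ball (min_le_left _ _) hw.2))
  have hidem : ∀ w : Esp d × Esp d, w.2 ≠ 0 → sphereProj η (sphereProj η w) = sphereProj η w :=
    fun w hw => sphereProj_of_norm_eq hη (norm_sphereProj_snd η hw)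
  have hVV₁ : ∀ w ∈ V, w ∈ V₁ := fun w hw => by
    refine ⟨hw.1, ?_⟩
    have := (hsub w hw).2
    rwa [hidem w hw.1] at this
  refine ⟨V, ψ, ‖η‖ ^ 2 * M / 2, c, δ, ⟨hVo, ⟨hη, ?_⟩, fun x ξ hw => ⟨hw.1, fun s hs => ?_⟩⟩, hδ,
    by positivity, by linarith, hc, ?_, fun w hw => (hψs w (hVV₁ w hw)).contDiffWithinAt,
    fun x ξ _ s hs => hψhom (x, ξ) s hs, ?_, ?_⟩
  · rw [hP0]; exact Metric.mem_ball_self (lt_min hr hδ)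
  · refine ⟨smul_ne_zero hs.ne' hw.1, ?_⟩
    rw [sphereProj_smul η x ξ hs]
    exact hw.2
  · intro t x ξ ht0 htδ hw
    have h1 := (hloc _ (Metric.ball_subset_ball (min_le_right _ _) hw.2) t ht0 htδ).1
    have hs : 0 < ‖ξ‖ / ‖η‖ := div_pos (norm_pos_iff.2 hw.1) hη'
    have h2 := (hcone _ _ _ h1).2 _ hs
    have hξ : ‖ξ‖ ≠ 0 := norm_ne_zero_iff.2 hw.1
    have e : ‖ξ‖ / ‖η‖ * (‖η‖ / ‖ξ‖) = 1 := by field_simp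
    simpa [sphereProj, smul_smul, e] using h2
  · exact hasSymbolBounds_of_homogeneous hη hV₁ (fun w hw => (hψs w hw).contDiffWithinAt)
      (fun w _ s hs => hψhom w s hs) hrV fun w hw => ⟨hw.1, hVV₁ w hw,
        Metric.ball_subset_closedBall (Metric.ball_subset_ball (min_le_left _ _) hw.2)⟩
  · intro t x ξ ht0 htδ hw
    have hξ : 0 < ‖ξ‖ := norm_pos_iff.2 hw.1
    have hs : 0 < ‖η‖ / ‖ξ‖ := div_pos hη' hξ
    obtain ⟨h1, h2, h3⟩ := hloc _ (Metric.ball_subset_ball (min_le_right _ _) hw.2) t ht0 htδ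
    have hxW : (t, x, ξ) ∈ W := by
      have h4 := (hcone _ _ _ h1).2 _ (inv_pos.2 hs)
      simpa [sphereProj, smul_smul, hξ.ne', hη'.ne'] using h4
    have haP : a (t, sphereProj η (x, ξ)) = a (t, x, ξ) := ha_hom _ _ _ hxW _ hs
    rw [haP] at h2 h3
    refine ⟨?_, h3⟩
    have hW_slice : ∀ᶠ w : Esp d × Esp d in 𝓝 (x, ξ), (t, w) ∈ W :=
      (Continuous.prodMk_right t).continuousAt.eventually_mem (hWo.mem_nhds hxW)
    -- By homogeneity of degree `-1`, `|ξ|² {ψ, a}²` equals its value at the projected point, where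
    -- the local estimate applies.
    have h5 : poissonBracket ψ (fun z => a (t, z)) (x, ξ) =
        ‖η‖ / ‖ξ‖ * poissonBracket ψ (fun z => a (t, z)) (sphereProj η (x, ξ)) :=
      poissonBracket_eq_of_fiberDilation_invariant hs.ne'
        (Eventually.of_forall fun w => hψhom w _ hs)
        (by filter_upwards [hW_slice] with w hw using ha_hom _ _ _ hw _ hs)
    rw [h5, poissonBracket_eq_fderiv_hamiltonField, fderiv_slice
      ((ha_smooth.contDiffAt (hWo.mem_nhds h1)).differentiableAt (by simp))]
    calc ‖ξ‖ ^ 2 * (‖η‖ / ‖ξ‖ * fderiv ℝ a (t, sphereProj η (x, ξ))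
          (0, hamiltonField ψ (sphereProj η (x, ξ)))) ^ 2
        = ‖η‖ ^ 2 * fderiv ℝ a (t, sphereProj η (x, ξ))
          (0, hamiltonField ψ (sphereProj η (x, ξ))) ^ 2 := by field_simp
      _ ≤ ‖η‖ ^ 2 * (2 * M * a (t, x, ξ)) := by gcongr
      _ = 4 * (‖η‖ ^ 2 * M / 2) * a (t, x, ξ) := by ring
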